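/- Let $R$ be a commutative ring, let $C$ and $D$ be (coassociative, counital) $R$-coalgebras that are flat as $R$-modules, and let $\mathcal M^C$, ${}^C\mathcal M$ denote the categories of right and left $C$-comodules with colinear maps (similarly for $D$). For a right $D$-comodule $X$ and a left $D$-comodule $P$ the cotensor product is $$X\,\square_D\,P=\ker\bigl(\varrho_X\otimes \mathrm{id}_P-\mathrm{id}_X\otimes\varrho_P : X\otimes_R P\to X\otimes_R D\otimes_R P\bigr);$$ if $X$ is a $C$-$D$-bicomodule, this is a left $C$-comodule by restricting $\varrho^-_X\otimes\mathrm{id}_P$, where $\varrho^-_X: X\to C\otimes_R X$ is the left coaction of $X$, and $X\,\square_D-$ is a functor ${}^D\mathcal M\to{}^C\mathcal M$. For an $R$-linear functor $F:\mathcal M^C\to\mathcal M^D$ and an $R$-module $W$ let $$\lambda^F_{W}: W\otimes_R F(C)\to F(W\otimes_R C),\qquad w\otimes x\mapsto F\bigl(c\mapsto w\otimes c\bigr)(x),$$ where $W\otimes_R C$ is a right $C$-comodule through $\mathrm{id}_W\otimes\Delta$. **Theorem.** Let $F:\mathcal M^C\to\mathcal M^D$ be an $R$-linear equivalence of categories with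 inverse $G:\mathcal M^D\to\mathcal M^C$. Then $\lambda^F_C: C\otimes_R F(C)\to F(C\otimes_R C)$ and $\lambda^G_D: D\otimes_R G(D)\to G(D\otimes_R D)$ are bijective; the maps $(\lambda^F_C)^{-1}\circ F(\Delta_C)$ and $(\lambda^G_D)^{-1}\circ G(\Delta_D)$ are left coactions making $F(C)$ a $C$-$D$-bicomodule and $G(D)$ a $D$-$C$-bicomodule; and the functor $$F(C)\,\square_D-\;:\;{}^D\mathcal M\to{}^C\mathcal M$$ is an $R$-linear equivalence of categories with inverse $G(D)\,\square_C-:{}^C\mathcal M\to{}^D\mathcal M$. In particular, if $\mathcal M^C$ is ($R$-linearly) equivalent to $\mathcal M^D$, then ${}^C\mathcal M$ is ($R$-linearly) equivalent to ${}^D\mathcal M$. -/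

import Mathlib

open CategoryTheory
open scoped TensorProduct

universe u

namespace MoritaTakeuchi

/-- A right coaction `ρ : M → M ⊗ C` of a coalgebra `C` on an `R`-module `M`. -/
structure RightCoaction (R C M : Type u) [CommRing R] [AddCommGroup C] [Module R C]
    [Coalgebra R C] [AddCommGroup M] [Module R M] where
  /-- the structure map -/
  map : M →ₗ[R] M ⊗[R] C
  coassoc : (TensorProduct.assoc R M C C).toLinearMap ∘ₗ map.rTensor C ∘ₗ map =
    (Coalgebra.comul (R := R) (A := C)).lTensor M ∘ₗ map
  counit : (TensorProduct.rid R M).toLinearMap ∘ₗ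
    (Coalgebra.counit (R := R) (A := C)).lTensor M ∘ₗ map = LinearMap.id

/-- A left coaction `ρ : M → C ⊗ M` of a coalgebra `C` on an `R`-module `M`. -/
structure LeftCoaction (R C M : Type u) [CommRing R] [AddCommGroup C] [Module R C]
    [Coalgebra R C] [AddCommGroup M] [Module R M] where
  /-- the structure map -/
  map : M →ₗ[R] C ⊗[R] M
  coassoc : map.lTensor C ∘ₗ map = (TensorProduct.assoc R C C M).toLinearMap ∘ₗ
    (Coalgebra.comul (R := R) (A := C)).rTensor M ∘ₗ map
  counit : (TensorProduct.lid R M).toLinearMap ∘ₗ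
    (Coalgebra.counit (R := R) (A := C)).rTensor M ∘ₗ map = LinearMap.id

/-- Right `C`-comodules. -/
structure RightComod (R C : Type u) [CommRing R] [AddCommGroup C] [Module R C]
    [Coalgebra R C] where
  /-- the underlying `R`-module -/
  carrier : Type u
  [addCommGroup : AddCommGroup carrier]
  [module : Module R carrier]
  /-- the coaction -/
  coaction : RightCoaction R C carrier

/-- Left `C`-comodules. -/
structure LeftComod (R C : Type u) [CommRing R] [AddCommGroup C] [Module R C]
    [Coalgebra R C] where
  /-- the underlying `R`-module -/
  carrier : Type u
  [addCommGroup : AddCommGroup carrier]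
  [module : Module R carrier]
  /-- the coaction -/
  coaction : LeftCoaction R C carrier

attribute [instance] RightComod.addCommGroup RightComod.module
  LeftComod.addCommGroup LeftComod.module

section Categories

variable {R C : Type u} [CommRing R] [AddCommGroup C] [Module R C] [Coalgebra R C]

/-- The `R`-module of `C`-colinear maps between right comodules. -/
def RightComod.colinear (M N : RightComod R C) : Submodule R (M.carrier →ₗ[R] N.carrier) where
  carrier := {f | N.coaction.map ∘ₗ f = f.rTensor C ∘ₗ M.coaction.map}
  add_mem' {f g} hf hg := by
    simp only [Set.mem_ofPred_eq] at hf hg ⊢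
    rw [LinearMap.comp_add, hf, hg, LinearMap.rTensor_add, LinearMap.add_comp]
  zero_mem' := by simp
  smul_mem' r f hf := by
    simp only [Set.mem_ofPred_eq] at hf ⊢
    rw [LinearMap.comp_smul, hf, LinearMap.rTensor_smul, LinearMap.smul_comp]

/-- The `R`-module of `C`-colinear maps between left comodules. -/
def LeftComod.colinear (M N : LeftComod R C) : Submodule R (M.carrier →ₗ[R] N.carrier) where
  carrier := {f | N.coaction.map ∘ₗ f = f.lTensor C ∘ₗ M.coaction.map}
  add_mem' {f g} hf hg := by
    simp only [Set.mem_ofPred_eq] at hf hg ⊢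
    rw [LinearMap.comp_add, hf, hg, LinearMap.lTensor_add, LinearMap.add_comp]
  zero_mem' := by simp
  smul_mem' r f hf := by
    simp only [Set.mem_ofPred_eq] at hf ⊢
    rw [LinearMap.comp_smul, hf, LinearMap.lTensor_smul, LinearMap.smul_comp]

/-- The category `M^C` of right `C`-comodules and colinear maps. -/
instance : Category.{u} (RightComod R C) where
  Hom M N := RightComod.colinear M N
  id M := ⟨LinearMap.id, by simp [RightComod.colinear]⟩
  comp {M N P} f g := ⟨g.1 ∘ₗ f.1, by
    have hf : _ = _ := f.2
    have hg : _ = _ := g.2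
    change _ = _
    rw [← LinearMap.comp_assoc, hg, LinearMap.comp_assoc, hf, LinearMap.rTensor_comp,
      LinearMap.comp_assoc]⟩

/-- The category `^C M` of left `C`-comodules and colinear maps. -/
instance : Category.{u} (LeftComod R C) where
  Hom M N := LeftComod.colinear M N
  id M := ⟨LinearMap.id, by simp [LeftComod.colinear]⟩
  comp {M N P} f g := ⟨g.1 ∘ₗ f.1, by
    have hf : _ = _ := f.2
    have hg : _ = _ := g.2
    change _ = _
    rw [← LinearMap.comp_assoc, hg, LinearMap.comp_assoc, hf, LinearMap.lTensor_comp,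
      LinearMap.comp_assoc]⟩

/-- The `R`-linear map underlying a morphism of right comodules. -/
def RightComod.lin {M N : RightComod R C} (f : M ⟶ N) : M.carrier →ₗ[R] N.carrier := f.1

/-- The `R`-linear map underlying a morphism of left comodules. -/
def LeftComod.lin {M N : LeftComod R C} (f : M ⟶ N) : M.carrier →ₗ[R] N.carrier := f.1

instance : Preadditive (RightComod R C) where
  homGroup M N := inferInstanceAs (AddCommGroup (RightComod.colinear M N))
  add_comp _ _ _ _ _ _ := Subtype.ext (LinearMap.comp_add _ _ _)
  comp_add _ _ _ _ _ _ := Subtype.ext (LinearMap.add_comp _ _ _)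

instance : Preadditive (LeftComod R C) where
  homGroup M N := inferInstanceAs (AddCommGroup (LeftComod.colinear M N))
  add_comp _ _ _ _ _ _ := Subtype.ext (LinearMap.comp_add _ _ _)
  comp_add _ _ _ _ _ _ := Subtype.ext (LinearMap.add_comp _ _ _)

instance : Linear R (RightComod R C) where
  homModule M N := inferInstanceAs (Module R (RightComod.colinear M N))
  smul_comp _ _ _ _ _ _ := Subtype.ext (LinearMap.comp_smul _ _ _)
  comp_smul _ _ _ _ _ _ := Subtype.ext (LinearMap.smul_comp _ _ _)

instance : Linear R (LeftComod R C) where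
  homModule M N := inferInstanceAs (Module R (LeftComod.colinear M N))
  smul_comp _ _ _ _ _ _ := Subtype.ext (LinearMap.comp_smul _ _ _)
  comp_smul _ _ _ _ _ _ := Subtype.ext (LinearMap.smul_comp _ _ _)

end Categories

section Free

variable {R : Type u} [CommRing R]

variable (R) in
/-- `C` as a right comodule over itself, with coaction `Δ`. -/
abbrev regular (C : Type u) [AddCommGroup C] [Module R C] [Coalgebra R C] : RightComod R C where
  carrier := C
  coaction :=
    { map := Coalgebra.comul
      coassoc := Coalgebra.coassoc
      counit := by
        ext c
        simp }

variable {C : Type u} [AddCommGroup C] [Module R C] [Coalgebra R C]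

/-- `W ⊗ M` for an `R`-module `W` and a right `C`-comodule `M`, with the coaction
`id_W ⊗ ρ_M`. -/
abbrev tensorRight (W : Type u) [AddCommGroup W] [Module R W] (M : RightComod R C) :
    RightComod R C where
  carrier := W ⊗[R] M.carrier
  coaction :=
    { map := (TensorProduct.assoc R W M.carrier C).symm.toLinearMap ∘ₗ
        M.coaction.map.lTensor W
      coassoc := by
        ext w m
        have h := LinearMap.congr_fun M.coaction.coassoc m
        simp only [LinearMap.comp_apply, LinearEquiv.coe_coe] at h
        have h1 : ∀ t : M.carrier ⊗[R] C,
            TensorProduct.assoc R (W ⊗[R] M.carrier) C C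
              (((TensorProduct.assoc R W M.carrier C).symm.toLinearMap ∘ₗ
                M.coaction.map.lTensor W).rTensor C
                ((TensorProduct.assoc R W M.carrier C).symm (w ⊗ₜ t))) =
            (TensorProduct.assoc R W M.carrier (C ⊗[R] C)).symm
              (w ⊗ₜ TensorProduct.assoc R M.carrier C C (M.coaction.map.rTensor C t)) := by
          intro t
          induction t with
          | zero => simp
          | add a b ha hb => simp only [TensorProduct.tmul_add, map_add, ha, hb]
          | tmul m' c =>
            simp only [TensorProduct.assoc_symm_tmul, LinearMap.rTensor_tmul,
              LinearMap.comp_apply, LinearMap.lTensor_tmul, LinearEquiv.coe_coe]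
            generalize M.coaction.map m' = t
            induction t with
            | zero => simp
            | add a b ha hb => simp only [TensorProduct.tmul_add, TensorProduct.add_tmul,
                map_add, ha, hb]
            | tmul m'' c' => simp
        have h2 : ∀ t : M.carrier ⊗[R] C,
            (Coalgebra.comul (R := R) (A := C)).lTensor (W ⊗[R] M.carrier)
                ((TensorProduct.assoc R W M.carrier C).symm (w ⊗ₜ t)) =
            (TensorProduct.assoc R W M.carrier (C ⊗[R] C)).symm
              (w ⊗ₜ (Coalgebra.comul (R := R) (A := C)).lTensor M.carrier t) := by
          intro t
          induction t with
          | zero => simp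
          | add a b ha hb => simp only [TensorProduct.tmul_add, map_add, ha, hb]
          | tmul m' c => simp
        simp only [TensorProduct.AlgebraTensorModule.curry_apply, TensorProduct.curry_apply,
          LinearMap.coe_restrictScalars, LinearMap.comp_apply, LinearEquiv.coe_coe,
          LinearMap.lTensor_tmul]
        rw [h1, h2, h]
      counit := by
        ext w m
        have h := LinearMap.congr_fun M.coaction.counit m
        simp only [LinearMap.comp_apply, LinearEquiv.coe_coe, LinearMap.id_apply] at h
        have h1 : ∀ t : M.carrier ⊗[R] C,
            TensorProduct.rid R (W ⊗[R] M.carrier)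
              ((Coalgebra.counit (R := R) (A := C)).lTensor (W ⊗[R] M.carrier)
                ((TensorProduct.assoc R W M.carrier C).symm (w ⊗ₜ t))) =
            w ⊗ₜ TensorProduct.rid R M.carrier
              ((Coalgebra.counit (R := R) (A := C)).lTensor M.carrier t) := by
          intro t
          induction t with
          | zero => simp
          | add a b ha hb => simp only [TensorProduct.tmul_add, map_add, ha, hb]
          | tmul m' c => simp
        simp only [TensorProduct.AlgebraTensorModule.curry_apply, TensorProduct.curry_apply,
          LinearMap.coe_restrictScalars, LinearMap.comp_apply, LinearEquiv.coe_coe,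
          LinearMap.lTensor_tmul, LinearMap.id_apply]
        rw [h1, h] }

/-- The colinear map `W → Hom(M, W ⊗ M)`, `w ↦ (m ↦ w ⊗ m)`. -/
def insertion (W : Type u) [AddCommGroup W] [Module R W] (M : RightComod R C) :
    W →ₗ[R] (M ⟶ tensorRight W M) where
  toFun w := ⟨TensorProduct.mk R W M.carrier w, by
    change (TensorProduct.assoc R W M.carrier C).symm.toLinearMap ∘ₗ M.coaction.map.lTensor W ∘ₗ
      TensorProduct.mk R W M.carrier w =
      (TensorProduct.mk R W M.carrier w).rTensor C ∘ₗ M.coaction.map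
    ext m
    simp only [LinearMap.comp_apply, TensorProduct.mk_apply, LinearEquiv.coe_coe,
      LinearMap.lTensor_tmul]
    generalize M.coaction.map m = t
    induction t with
    | zero => simp
    | add a b ha hb => simp only [TensorProduct.tmul_add, map_add, ha, hb]
    | tmul m' c => simp⟩
  map_add' w w' := Subtype.ext (map_add (TensorProduct.mk R W M.carrier) w w')
  map_smul' r w := Subtype.ext (map_smul (TensorProduct.mk R W M.carrier) r w)

variable (R C) in
/-- The comultiplication as a morphism of right comodules `C ⟶ C ⊗ C`. -/
def comulHom : regular R C ⟶ tensorRight C (regular R C) :=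
  ⟨Coalgebra.comul (R := R) (A := C), by
    change (TensorProduct.assoc R C C C).symm.toLinearMap ∘ₗ
      (Coalgebra.comul (R := R) (A := C)).lTensor C ∘ₗ Coalgebra.comul (R := R) (A := C) =
      (Coalgebra.comul (R := R) (A := C)).rTensor C ∘ₗ Coalgebra.comul (R := R) (A := C)
    rw [← Coalgebra.coassoc]
    ext c
    simp⟩

end Free

section Lambda

variable {R C D : Type u} [CommRing R] [AddCommGroup C] [Module R C] [Coalgebra R C]
  [AddCommGroup D] [Module R D] [Coalgebra R D]

/-- `f ↦ (underlying linear map of f)` as a linear map. -/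
def RightComod.linₗ (M N : RightComod R C) : (M ⟶ N) →ₗ[R] (M.carrier →ₗ[R] N.carrier) :=
  (RightComod.colinear M N).subtype

/-- For an `R`-linear functor `F : M^C ⥤ M^D`, the canonical map
`λ_{W,M} : W ⊗ F(M) → F(W ⊗ M)`, `w ⊗ x ↦ F(m ↦ w ⊗ m)(x)`; it is the natural
transformation in `W` which for `W = R` is the canonical isomorphism
`R ⊗ F(M) ≅ F(M) ≅ F(R ⊗ M)`. -/
def lam (F : RightComod R C ⥤ RightComod R D) [F.Additive] [F.Linear R]
    (W : Type u) [AddCommGroup W] [Module R W] (M : RightComod R C) :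
    W ⊗[R] (F.obj M).carrier →ₗ[R] (F.obj (tensorRight W M)).carrier :=
  TensorProduct.lift
    (RightComod.linₗ _ _ ∘ₗ F.mapLinearMap R ∘ₗ insertion W M)

end Lambda

theorem lTensor_subtype_injective {R C : Type u} [CommRing R] [AddCommGroup C] [Module R C]
    [Module.Flat R C] {M : Type u} [AddCommGroup M] [Module R M] (K : Submodule R M) :
    Function.Injective (K.subtype.lTensor C) :=
  Module.Flat.lTensor_preserves_injective_linearMap _ K.injective_subtype

section Cotensor

variable {R C D : Type u} [CommRing R] [AddCommGroup C] [Module R C] [Coalgebra R C]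
  [AddCommGroup D] [Module R D] [Coalgebra R D]

/-- A left `C`-coaction and a right `D`-coaction on `M` are compatible if
the left coaction `M → C ⊗ M` is right `D`-colinear, where `C ⊗ M` has the right
coaction `id_C ⊗ ρ_M`. -/
def Compatible {M : Type u} [AddCommGroup M] [Module R M] (l : LeftCoaction R C M)
    (r : RightCoaction R D M) : Prop :=
  ((TensorProduct.assoc R C M D).symm.toLinearMap ∘ₗ r.map.lTensor C) ∘ₗ l.map =
    l.map.rTensor D ∘ₗ r.map

variable (R C D) in
/-- `C`-`D`-bicomodules. -/
structure Bicomod where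
  /-- the underlying right `D`-comodule -/
  right : RightComod R D
  /-- the left `C`-coaction -/
  left : LeftCoaction R C right.carrier
  compatible : Compatible left right.coaction

/-- The map `ρ_X ⊗ id - id ⊗ ρ_P : X ⊗ P → X ⊗ D ⊗ P`. -/
def cotensorMap (X : RightComod R D) (P : LeftComod R D) :
    X.carrier ⊗[R] P.carrier →ₗ[R] X.carrier ⊗[R] (D ⊗[R] P.carrier) :=
  (TensorProduct.assoc R X.carrier D P.carrier).toLinearMap ∘ₗ
    X.coaction.map.rTensor P.carrier - P.coaction.map.lTensor X.carrier

/-- The cotensor product `X □_D P`, as a submodule of `X ⊗ P`. -/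
abbrev cotensor (X : RightComod R D) (P : LeftComod R D) :
    Submodule R (X.carrier ⊗[R] P.carrier) :=
  LinearMap.ker (cotensorMap X P)

/-- `X ⊗ V` for a left coaction on `X` and an `R`-module `V`, with the coaction
`ρ_X ⊗ id_V`. -/
def LeftCoaction.tensor {X : Type u} [AddCommGroup X] [Module R X] (l : LeftCoaction R C X)
    (V : Type u) [AddCommGroup V] [Module R V] : LeftCoaction R C (X ⊗[R] V) where
  map := (TensorProduct.assoc R C X V).toLinearMap ∘ₗ l.map.rTensor V
  coassoc := by
    ext x v
    have h := LinearMap.congr_fun l.coassoc x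
    simp only [LinearMap.comp_apply, LinearEquiv.coe_coe] at h
    have h1 : ∀ t : C ⊗[R] X,
        ((TensorProduct.assoc R C X V).toLinearMap ∘ₗ l.map.rTensor V).lTensor C
          (TensorProduct.assoc R C X V (t ⊗ₜ v)) =
        (TensorProduct.assoc R C (C ⊗[R] X) V (l.map.lTensor C t ⊗ₜ v) |>
          (TensorProduct.assoc R C X V).toLinearMap.lTensor C) := by
      intro t
      induction t with
      | zero => simp
      | add a b ha hb => simp only [TensorProduct.add_tmul, map_add, ha, hb]
      | tmul c x' => simp
    have h2 : ∀ t : C ⊗[R] X,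
        TensorProduct.assoc R C C (X ⊗[R] V)
          ((Coalgebra.comul (R := R) (A := C)).rTensor (X ⊗[R] V)
            (TensorProduct.assoc R C X V (t ⊗ₜ v))) =
        (TensorProduct.assoc R C (C ⊗[R] X) V
          (TensorProduct.assoc R C C X
            ((Coalgebra.comul (R := R) (A := C)).rTensor X t) ⊗ₜ v) |>
          (TensorProduct.assoc R C X V).toLinearMap.lTensor C) := by
      intro t
      induction t with
      | zero => simp
      | add a b ha hb => simp only [TensorProduct.add_tmul, map_add, ha, hb]
      | tmul c x' =>
        simp only [TensorProduct.assoc_tmul, LinearMap.rTensor_tmul]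
        generalize Coalgebra.comul (R := R) c = s
        induction s with
        | zero => simp
        | add a b ha hb => simp only [TensorProduct.add_tmul, map_add, ha, hb]
        | tmul c1 c2 => simp
    simp only [TensorProduct.AlgebraTensorModule.curry_apply, TensorProduct.curry_apply,
      LinearMap.coe_restrictScalars, LinearMap.comp_apply, LinearEquiv.coe_coe,
      LinearMap.rTensor_tmul]
    rw [h1, h2, h]
  counit := by
    ext x v
    have h := LinearMap.congr_fun l.counit x
    simp only [LinearMap.comp_apply, LinearEquiv.coe_coe, LinearMap.id_apply] at h
    have h1 : ∀ t : C ⊗[R] X,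
        TensorProduct.lid R (X ⊗[R] V)
          ((Coalgebra.counit (R := R) (A := C)).rTensor (X ⊗[R] V)
            (TensorProduct.assoc R C X V (t ⊗ₜ v))) =
        TensorProduct.lid R X
          ((Coalgebra.counit (R := R) (A := C)).rTensor X t) ⊗ₜ v := by
      intro t
      induction t with
      | zero => simp
      | add a b ha hb => simp only [TensorProduct.add_tmul, map_add, ha, hb]
      | tmul c x' => simp [TensorProduct.smul_tmul']
    simp only [TensorProduct.AlgebraTensorModule.curry_apply, TensorProduct.curry_apply,
      LinearMap.coe_restrictScalars, LinearMap.comp_apply, LinearEquiv.coe_coe,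
      LinearMap.rTensor_tmul, LinearMap.id_apply]
    rw [h1, h]

/-- Auxiliary: if `C` is flat, an element of the kernel of a left colinear map `f : M → N` has
its coaction in the image of `C ⊗ ker f`. -/
theorem coaction_mem_range [Module.Flat R C] {M N : Type u} [AddCommGroup M] [Module R M]
    [AddCommGroup N] [Module R N] (lM : LeftCoaction R C M) (lN : LeftCoaction R C N)
    (f : M →ₗ[R] N) (hf : lN.map ∘ₗ f = f.lTensor C ∘ₗ lM.map) (z : LinearMap.ker f) :
    lM.map z ∈ LinearMap.range ((LinearMap.ker f).subtype.lTensor C) := by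
  have hex := Module.Flat.lTensor_exact C (f := (LinearMap.ker f).subtype) (g := f)
    (LinearMap.exact_subtype_ker_map f)
  refine (hex _).1 ?_
  have h := LinearMap.congr_fun hf z
  simp only [LinearMap.comp_apply] at h
  rw [← h, LinearMap.mem_ker.1 z.2, map_zero]

/-- The structure map `ker f → C ⊗ ker f` obtained by restricting the coaction of `M`, for `f`
left `C`-colinear and `C` flat. -/
noncomputable def kerMap [Module.Flat R C] {M N : Type u} [AddCommGroup M] [Module R M]
    [AddCommGroup N] [Module R N] (lM : LeftCoaction R C M) (lN : LeftCoaction R C N)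
    (f : M →ₗ[R] N) (hf : lN.map ∘ₗ f = f.lTensor C ∘ₗ lM.map) :
    LinearMap.ker f →ₗ[R] C ⊗[R] LinearMap.ker f :=
  (LinearEquiv.ofInjective _ (lTensor_subtype_injective (C := C)
      (LinearMap.ker f))).symm.toLinearMap ∘ₗ
    (lM.map ∘ₗ (LinearMap.ker f).subtype).codRestrict _ (coaction_mem_range lM lN f hf)

theorem lTensor_comp_kerMap [Module.Flat R C] {M N : Type u} [AddCommGroup M] [Module R M]
    [AddCommGroup N] [Module R N] (lM : LeftCoaction R C M) (lN : LeftCoaction R C N)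
    (f : M →ₗ[R] N) (hf : lN.map ∘ₗ f = f.lTensor C ∘ₗ lM.map) :
    (LinearMap.ker f).subtype.lTensor C ∘ₗ kerMap lM lN f hf =
      lM.map ∘ₗ (LinearMap.ker f).subtype := by
  ext z
  exact congrArg Subtype.val (LinearEquiv.apply_symm_apply
    (LinearEquiv.ofInjective _ (lTensor_subtype_injective (C := C) (LinearMap.ker f)))
    ((lM.map ∘ₗ (LinearMap.ker f).subtype).codRestrict _ (coaction_mem_range lM lN f hf) z))

/-- The kernel of a left colinear map, as a left comodule, for `C` flat: the coaction is the one
for which the inclusion `ker f → M` is colinear. -/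
noncomputable def kerCoaction [Module.Flat R C] {M N : Type u} [AddCommGroup M] [Module R M]
    [AddCommGroup N] [Module R N] (lM : LeftCoaction R C M) (lN : LeftCoaction R C N)
    (f : M →ₗ[R] N) (hf : lN.map ∘ₗ f = f.lTensor C ∘ₗ lM.map) :
    LeftCoaction R C (LinearMap.ker f) where
  map := kerMap lM lN f hf
  coassoc := by
    have key := lTensor_comp_kerMap lM lN f hf
    set ι := (LinearMap.ker f).subtype with hι
    set κ := kerMap lM lN f hf
    have hinj : Function.Injective ((ι.lTensor C).lTensor C) :=
      Module.Flat.lTensor_preserves_injective_linearMap _ (lTensor_subtype_injective _)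
    rw [← LinearMap.cancel_left hinj]
    have h1 : (ι.lTensor C).lTensor C ∘ₗ (κ.lTensor C ∘ₗ κ) =
        lM.map.lTensor C ∘ₗ lM.map ∘ₗ ι := by
      rw [← LinearMap.comp_assoc, ← LinearMap.lTensor_comp, key, LinearMap.lTensor_comp,
        LinearMap.comp_assoc, key]
    have h2 : (ι.lTensor C).lTensor C ∘ₗ (TensorProduct.assoc R C C _).toLinearMap ∘ₗ
        (Coalgebra.comul (R := R) (A := C)).rTensor _ =
        (TensorProduct.assoc R C C M).toLinearMap ∘ₗ
        (Coalgebra.comul (R := R) (A := C)).rTensor M ∘ₗ ι.lTensor C := by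
      ext c z
      simp only [TensorProduct.AlgebraTensorModule.curry_apply, TensorProduct.curry_apply,
        LinearMap.coe_restrictScalars, LinearMap.comp_apply, LinearEquiv.coe_coe,
        LinearMap.rTensor_tmul, LinearMap.lTensor_tmul]
      generalize Coalgebra.comul (R := R) c = s
      induction s with
      | zero => simp
      | add a b ha hb => simp only [TensorProduct.add_tmul, map_add, ha, hb]
      | tmul c1 c2 => simp
    rw [h1, ← LinearMap.comp_assoc, lM.coassoc]
    have h3 := congrArg (fun g => g ∘ₗ κ) h2
    simp only [LinearMap.comp_assoc] at h3 ⊢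
    rw [h3, key]
  counit := by
    have key := lTensor_comp_kerMap lM lN f hf
    set ι := (LinearMap.ker f).subtype with hι
    set κ := kerMap lM lN f hf
    rw [← LinearMap.cancel_left (LinearMap.ker f).injective_subtype, ← hι]
    have h2 : ι ∘ₗ (TensorProduct.lid R _).toLinearMap ∘ₗ
        (Coalgebra.counit (R := R) (A := C)).rTensor _ =
        (TensorProduct.lid R M).toLinearMap ∘ₗ
        (Coalgebra.counit (R := R) (A := C)).rTensor M ∘ₗ ι.lTensor C := by
      ext c z
      simp
    have h3 := congrArg (fun g => g ∘ₗ κ) h2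
    have h4 := congrArg (fun g => g ∘ₗ ι) lM.counit
    simp only [LinearMap.comp_assoc] at h3 h4 ⊢
    rw [h3, key, h4]
    rfl

/-- `ρ_X ⊗ id - id ⊗ ρ_P` is left `C`-colinear for a `C`-`D`-bicomodule `X`. -/
theorem cotensorMap_colinear (X : Bicomod R C D) (P : LeftComod R D) :
    (X.left.tensor (D ⊗[R] P.carrier)).map ∘ₗ cotensorMap X.right P =
      (cotensorMap X.right P).lTensor C ∘ₗ (X.left.tensor P.carrier).map := by
  have h1 : (X.left.tensor (D ⊗[R] P.carrier)).map ∘ₗ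
      P.coaction.map.lTensor X.right.carrier =
      (P.coaction.map.lTensor X.right.carrier).lTensor C ∘ₗ
        (X.left.tensor P.carrier).map := by
    ext x p
    simp only [LeftCoaction.tensor, TensorProduct.AlgebraTensorModule.curry_apply,
      TensorProduct.curry_apply,
      LinearMap.coe_restrictScalars, LinearMap.comp_apply, LinearEquiv.coe_coe,
      LinearMap.rTensor_tmul, LinearMap.lTensor_tmul]
    generalize X.left.map x = s
    induction s with
    | zero => simp
    | add a b ha hb => simp only [TensorProduct.add_tmul, map_add, ha, hb]
    | tmul c1 c2 => simp
  have h2 : (X.left.tensor (D ⊗[R] P.carrier)).map ∘ₗ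
      ((TensorProduct.assoc R X.right.carrier D P.carrier).toLinearMap ∘ₗ
        X.right.coaction.map.rTensor P.carrier) =
      ((TensorProduct.assoc R X.right.carrier D P.carrier).toLinearMap ∘ₗ
        X.right.coaction.map.rTensor P.carrier).lTensor C ∘ₗ
        (X.left.tensor P.carrier).map := by
    ext x p
    have h := LinearMap.congr_fun X.compatible x
    simp only [LinearMap.comp_apply, LinearEquiv.coe_coe] at h
    have ha : ∀ t : X.right.carrier ⊗[R] D,
        (X.left.tensor (D ⊗[R] P.carrier)).map
          (TensorProduct.assoc R X.right.carrier D P.carrier (t ⊗ₜ p)) =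
        ((TensorProduct.assoc R X.right.carrier D P.carrier).toLinearMap.lTensor C ∘ₗ
          (TensorProduct.assoc R C (X.right.carrier ⊗[R] D) P.carrier).toLinearMap ∘ₗ
          (TensorProduct.assoc R C X.right.carrier D).toLinearMap.rTensor P.carrier)
          (X.left.map.rTensor D t ⊗ₜ p) := by
      intro t
      induction t with
      | zero => simp
      | add a b ha hb => simp only [TensorProduct.add_tmul, map_add, ha, hb]
      | tmul x' d =>
        simp only [LeftCoaction.tensor, LinearMap.comp_apply, LinearEquiv.coe_coe,
          LinearMap.rTensor_tmul, TensorProduct.assoc_tmul]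
        generalize X.left.map x' = s
        induction s with
        | zero => simp
        | add a b ha hb => simp only [TensorProduct.add_tmul, map_add, ha, hb]
        | tmul c1 c2 => simp
    have hb : ∀ t : C ⊗[R] X.right.carrier,
        ((TensorProduct.assoc R X.right.carrier D P.carrier).toLinearMap ∘ₗ
          X.right.coaction.map.rTensor P.carrier).lTensor C
          (TensorProduct.assoc R C X.right.carrier P.carrier (t ⊗ₜ p)) =
        ((TensorProduct.assoc R X.right.carrier D P.carrier).toLinearMap.lTensor C ∘ₗ
          (TensorProduct.assoc R C (X.right.carrier ⊗[R] D) P.carrier).toLinearMap ∘ₗ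
          (TensorProduct.assoc R C X.right.carrier D).toLinearMap.rTensor P.carrier)
          ((TensorProduct.assoc R C X.right.carrier D).symm
            (X.right.coaction.map.lTensor C t) ⊗ₜ p) := by
      intro t
      induction t with
      | zero => simp
      | add a b ha hb => simp only [TensorProduct.add_tmul, map_add, ha, hb]
      | tmul c x' => simp
    simp only [TensorProduct.AlgebraTensorModule.curry_apply,
      TensorProduct.curry_apply,
      LinearMap.coe_restrictScalars, LinearMap.comp_apply, LinearEquiv.coe_coe,
      LinearMap.rTensor_tmul]
    rw [ha, ← h, ← hb]
    simp [LeftCoaction.tensor]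
  rw [cotensorMap, LinearMap.comp_sub, h1, h2, LinearMap.lTensor_sub, LinearMap.sub_comp]

/-- `X □_D P` as a left `C`-comodule, for `X` a `C`-`D`-bicomodule, `P` a left `D`-comodule and
`C` flat over `R`; the coaction is the restriction of `ρ_X ⊗ id_P`. -/
noncomputable abbrev cotensorObj [Module.Flat R C] (X : Bicomod R C D) (P : LeftComod R D) :
    LeftComod R C where
  carrier := cotensor X.right P
  coaction := kerCoaction (X.left.tensor P.carrier) (X.left.tensor (D ⊗[R] P.carrier))
    (cotensorMap X.right P) (cotensorMap_colinear X P)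

theorem cotensorMap_natural (X : RightComod R D) {P Q : LeftComod R D} (f : P ⟶ Q) :
    cotensorMap X Q ∘ₗ (LeftComod.lin f).lTensor X.carrier =
      ((LeftComod.lin f).lTensor D).lTensor X.carrier ∘ₗ cotensorMap X P := by
  have hf : Q.coaction.map ∘ₗ LeftComod.lin f =
    (LeftComod.lin f).lTensor D ∘ₗ P.coaction.map := f.2
  rw [cotensorMap, cotensorMap, LinearMap.sub_comp, LinearMap.comp_sub,
    ← LinearMap.lTensor_comp, hf, LinearMap.lTensor_comp]
  congr 1
  ext x p
  simp only [TensorProduct.AlgebraTensorModule.curry_apply, TensorProduct.curry_apply,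
    LinearMap.coe_restrictScalars, LinearMap.comp_apply, LinearEquiv.coe_coe,
    LinearMap.rTensor_tmul, LinearMap.lTensor_tmul]
  generalize X.coaction.map x = s
  induction s with
  | zero => simp
  | add a b ha hb => simp only [TensorProduct.add_tmul, map_add, ha, hb]
  | tmul c1 c2 => simp

/-- The map `id_X □ f : X □_D P → X □_D Q`, the restriction of `id_X ⊗ f`. -/
def cotensorLin (X : RightComod R D) {P Q : LeftComod R D} (f : P ⟶ Q) :
    cotensor X P →ₗ[R] cotensor X Q :=
  ((LeftComod.lin f).lTensor X.carrier).restrict (by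
    intro z hz
    have h := LinearMap.congr_fun (cotensorMap_natural X f) z
    simp only [LinearMap.comp_apply] at h
    change cotensorMap X Q _ = 0
    have hz' : cotensorMap X P z = 0 := hz
    rw [h, hz', map_zero])

theorem cotensorLin_colinear [Module.Flat R C] (X : Bicomod R C D) {P Q : LeftComod R D}
    (f : P ⟶ Q) :
    cotensorLin X.right f ∈ LeftComod.colinear (cotensorObj X P) (cotensorObj X Q) := by
  change (cotensorObj X Q).coaction.map ∘ₗ cotensorLin X.right f =
    (cotensorLin X.right f).lTensor C ∘ₗ (cotensorObj X P).coaction.map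
  have hP : (cotensor X.right P).subtype.lTensor C ∘ₗ (cotensorObj X P).coaction.map =
      (X.left.tensor P.carrier).map ∘ₗ (cotensor X.right P).subtype :=
    lTensor_comp_kerMap _ _ _ (cotensorMap_colinear X P)
  have hQ : (cotensor X.right Q).subtype.lTensor C ∘ₗ (cotensorObj X Q).coaction.map =
      (X.left.tensor Q.carrier).map ∘ₗ (cotensor X.right Q).subtype :=
    lTensor_comp_kerMap _ _ _ (cotensorMap_colinear X Q)
  have hι : (cotensor X.right Q).subtype ∘ₗ cotensorLin X.right f =
      (LeftComod.lin f).lTensor X.right.carrier ∘ₗ (cotensor X.right P).subtype := rfl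
  have hn : (X.left.tensor Q.carrier).map ∘ₗ (LeftComod.lin f).lTensor X.right.carrier =
      ((LeftComod.lin f).lTensor X.right.carrier).lTensor C ∘ₗ
        (X.left.tensor P.carrier).map := by
    ext x p
    simp only [LeftCoaction.tensor, TensorProduct.AlgebraTensorModule.curry_apply,
      TensorProduct.curry_apply,
      LinearMap.coe_restrictScalars, LinearMap.comp_apply, LinearEquiv.coe_coe,
      LinearMap.rTensor_tmul, LinearMap.lTensor_tmul]
    generalize X.left.map x = s
    induction s with
    | zero => simp
    | add a b ha hb => simp only [TensorProduct.add_tmul, map_add, ha, hb]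
    | tmul c1 c2 => simp
  have hinj := lTensor_subtype_injective (C := C) (cotensor X.right Q)
  refine (LinearMap.cancel_left hinj).1 ?_
  have e1 : (cotensor X.right Q).subtype.lTensor C ∘ₗ
      ((cotensorObj X Q).coaction.map ∘ₗ cotensorLin X.right f) =
      (X.left.tensor Q.carrier).map ∘ₗ ((cotensor X.right Q).subtype ∘ₗ
        cotensorLin X.right f) :=
    congrArg (fun g => g ∘ₗ cotensorLin X.right f) hQ
  have e2 : (cotensor X.right Q).subtype.lTensor C ∘ₗ
      ((cotensorLin X.right f).lTensor C ∘ₗ (cotensorObj X P).coaction.map) =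
      ((cotensor X.right Q).subtype ∘ₗ cotensorLin X.right f).lTensor C ∘ₗ
        (cotensorObj X P).coaction.map := by
    rw [LinearMap.lTensor_comp]
    rfl
  refine e1.trans (Eq.trans ?_ e2.symm)
  rw [hι, LinearMap.lTensor_comp, LinearMap.comp_assoc, hP, ← LinearMap.comp_assoc, hn]
  rfl

/-- The cotensor functor `X □_D - : ^D M ⥤ ^C M` of a `C`-`D`-bicomodule `X`, for `C` flat. -/
noncomputable def cotensorFunctor [Module.Flat R C] (X : Bicomod R C D) :
    LeftComod R D ⥤ LeftComod R C where
  obj P := cotensorObj X P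
  map f := ⟨cotensorLin X.right f, cotensorLin_colinear X f⟩
  map_id P := by
    refine Subtype.ext (LinearMap.ext fun z => Subtype.ext ?_)
    exact LinearMap.congr_fun (LinearMap.lTensor_id X.right.carrier P.carrier) z.1
  map_comp f g := by
    refine Subtype.ext (LinearMap.ext fun z => Subtype.ext ?_)
    exact LinearMap.congr_fun
      (LinearMap.lTensor_comp X.right.carrier (LeftComod.lin g) (LeftComod.lin f)) z.1

end Cotensor

end MoritaTakeuchi

namespace MoritaTakeuchi

/-! The proof rests on a universal property: `W ⊗ M` is the copower of the comodule `M` by the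
module `W`, i.e. colinear maps `W ⊗ M → N` are linear maps `W → Hom(M, N)`. An `R`-linear
equivalence preserves copowers, so every `lam F W M` is bijective, not only the one for `W = C` and
`M = C`. Through these isomorphisms the coalgebra identities of `Δ` pass to `λ⁻¹ ∘ F(Δ)`, which is
therefore a left coaction; it is compatible with the right coaction because it is a morphism of
`M^D`.

For the inverse functors, every comodule `V` is the kernel of `ρ ⊗ id - id ⊗ Δ : V ⊗ D → V ⊗ D ⊗ D`
(`isKernel_coactionHom`). Applying `G` to this kernel for `V = W ⊗ F(C)`, and removing `G` by means
of `λ`, shows that `W ⊗ C ≅ W ⊗ GF(C)` is the kernel of `W ⊗ F(C) ⊗ G(D) → W ⊗ F(C) ⊗ D ⊗ G(D)`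
(`isKernel_unitHom`). Thus `C ≅ F(C) □ G(D)` as bicomodules, and this cotensor product commutes with
all tensor products.

This purity gives `N ≅ C □ N ≅ (F(C) □ G(D)) □ N ≅ F(C) □ (G(D) □ N)`; the last step compares two
submodules of `F(C) ⊗ (G(D) ⊗ N)` (`mem_range_unitMap`, `mem_range_cotensorIncl`) and uses that
`F(C)` is flat (`flat_obj_regular`). Exchanging `F` and `G` gives the other isomorphism. -/

theorem rTensor_subtype_injective {R C : Type u} [CommRing R] [AddCommGroup C] [Module R C]
    [Module.Flat R C] {M : Type u} [AddCommGroup M] [Module R M] (K : Submodule R M) :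
    Function.Injective (K.subtype.rTensor C) :=
  Module.Flat.rTensor_preserves_injective_linearMap _ K.injective_subtype

/-! ### Kernels of right comodules over a flat coalgebra -/

section RightKernel

variable {R C : Type u} [CommRing R] [AddCommGroup C] [Module R C] [Coalgebra R C]

namespace RightComod

theorem hom_ext {M N : RightComod R C} {f g : M ⟶ N} (h : lin f = lin g) : f = g :=
  Subtype.ext h

theorem lin_comp {M N P : RightComod R C} (f : M ⟶ N) (g : N ⟶ P) :
    lin (f ≫ g) = lin g ∘ₗ lin f := rfl

theorem lin_sub {M N : RightComod R C} (f g : M ⟶ N) : lin (f - g) = lin f - lin g := rfl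

theorem lin_colinear {M N : RightComod R C} (f : M ⟶ N) :
    N.coaction.map ∘ₗ lin f = (lin f).rTensor C ∘ₗ M.coaction.map := f.2

theorem bijective_lin {M N : RightComod R C} (f : M ⟶ N) [IsIso f] :
    Function.Bijective (lin f) := by
  refine Function.bijective_iff_has_inverse.2 ⟨lin (inv f), fun x => ?_, fun x => ?_⟩
  · exact LinearMap.congr_fun (congrArg lin (IsIso.hom_inv_id f)) x
  · exact LinearMap.congr_fun (congrArg lin (IsIso.inv_hom_id f)) x

/-- Flatness identifies `ker f ⊗ C` with the kernel of `f ⊗ id_C`, and colinearity of `f` puts the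
coaction of `ker f` there. -/
theorem coaction_mem_range [Module.Flat R C] {M N : RightComod R C} (f : M ⟶ N)
    (z : LinearMap.ker (lin f)) :
    M.coaction.map z ∈ LinearMap.range ((LinearMap.ker (lin f)).subtype.rTensor C) := by
  have hex := Module.Flat.rTensor_exact C (f := (LinearMap.ker (lin f)).subtype) (g := lin f)
    (LinearMap.exact_subtype_ker_map (lin f))
  refine (hex _).1 ?_
  have h := LinearMap.congr_fun (lin_colinear f) z
  simp only [LinearMap.comp_apply] at h
  rw [← h, LinearMap.mem_ker.1 z.2, map_zero]

/-- The restriction of the coaction of `M` to the kernel of a colinear map, for `C` flat. -/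
noncomputable def kerMap [Module.Flat R C] {M N : RightComod R C} (f : M ⟶ N) :
    LinearMap.ker (lin f) →ₗ[R] LinearMap.ker (lin f) ⊗[R] C :=
  (LinearEquiv.ofInjective _ (rTensor_subtype_injective (C := C)
      (LinearMap.ker (lin f)))).symm.toLinearMap ∘ₗ
    (M.coaction.map ∘ₗ (LinearMap.ker (lin f)).subtype).codRestrict _ (coaction_mem_range f)

theorem rTensor_comp_kerMap [Module.Flat R C] {M N : RightComod R C} (f : M ⟶ N) :
    (LinearMap.ker (lin f)).subtype.rTensor C ∘ₗ kerMap f =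
      M.coaction.map ∘ₗ (LinearMap.ker (lin f)).subtype := by
  ext z
  exact congrArg Subtype.val (LinearEquiv.apply_symm_apply
    (LinearEquiv.ofInjective _ (rTensor_subtype_injective (C := C) (LinearMap.ker (lin f))))
    ((M.coaction.map ∘ₗ (LinearMap.ker (lin f)).subtype).codRestrict _ (coaction_mem_range f) z))

/-- The kernel of a colinear map of right comodules, for `C` flat. -/
noncomputable abbrev ker [Module.Flat R C] {M N : RightComod R C} (f : M ⟶ N) :
    RightComod R C where
  carrier := LinearMap.ker (lin f)
  coaction :=
    { map := kerMap f
      coassoc := by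
        have key := rTensor_comp_kerMap f
        set ι := (LinearMap.ker (lin f)).subtype with hι
        set κ := kerMap f
        have hinj : Function.Injective (ι.rTensor (C ⊗[R] C)) :=
          Module.Flat.rTensor_preserves_injective_linearMap _
            (LinearMap.ker (lin f)).injective_subtype
        -- `C ⊗ C` is flat, so coassociativity may be checked in `M ⊗ (C ⊗ C)`, where it is that of
        -- `M`.
        rw [← LinearMap.cancel_left hinj]
        have h1 : ι.rTensor (C ⊗[R] C) ∘ₗ (TensorProduct.assoc R _ C C).toLinearMap =
            (TensorProduct.assoc R _ C C).toLinearMap ∘ₗ (ι.rTensor C).rTensor C := by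
          ext; rfl
        have h2 : ι.rTensor (C ⊗[R] C) ∘ₗ (Coalgebra.comul (R := R) (A := C)).lTensor _ =
            (Coalgebra.comul (R := R) (A := C)).lTensor _ ∘ₗ ι.rTensor C := by
          ext; rfl
        have h3 : (ι.rTensor C).rTensor C ∘ₗ κ.rTensor C =
            M.coaction.map.rTensor C ∘ₗ ι.rTensor C := by
          rw [← LinearMap.rTensor_comp, key, LinearMap.rTensor_comp]
        ext z : 1
        have k1 := LinearMap.congr_fun h1 (κ.rTensor C (κ z))
        have k2 := LinearMap.congr_fun h2 (κ z)
        have k3 := LinearMap.congr_fun h3 (κ z)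
        have k4 := LinearMap.congr_fun key z
        have k5 := LinearMap.congr_fun M.coaction.coassoc (ι z)
        simp only [LinearMap.comp_apply] at k1 k2 k3 k4 k5 ⊢
        rw [k1, k2, k3, k4, k5]
      counit := by
        have key := rTensor_comp_kerMap f
        set ι := (LinearMap.ker (lin f)).subtype with hι
        set κ := kerMap f
        rw [← LinearMap.cancel_left (LinearMap.ker (lin f)).injective_subtype, ← hι]
        have h2 : ι ∘ₗ (TensorProduct.rid R _).toLinearMap ∘ₗ
            (Coalgebra.counit (R := R) (A := C)).lTensor _ =
            (TensorProduct.rid R M.carrier).toLinearMap ∘ₗ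
            (Coalgebra.counit (R := R) (A := C)).lTensor M.carrier ∘ₗ ι.rTensor C := by
          ext z c
          simp
        have h3 := congrArg (fun g => g ∘ₗ κ) h2
        have h4 := congrArg (fun g => g ∘ₗ ι) M.coaction.counit
        simp only [LinearMap.comp_assoc] at h3 h4 ⊢
        rw [h3, key, h4]
        rfl }

/-- The inclusion of the kernel of a colinear map. -/
noncomputable def kerι [Module.Flat R C] {M N : RightComod R C} (f : M ⟶ N) : ker f ⟶ M :=
  ⟨(LinearMap.ker (lin f)).subtype, (rTensor_comp_kerMap f).symm⟩

theorem kerι_comp [Module.Flat R C] {M N : RightComod R C} (f : M ⟶ N) : kerι f ≫ f = 0 :=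
  hom_ext (LinearMap.ext fun z => z.2)

/-- The linear kernel is itself a comodule, so a monomorphism can be tested against its inclusion,
which must then vanish. This is how categorical information returns to modules. -/
theorem injective_of_mono [Module.Flat R C] {M N : RightComod R C} (f : M ⟶ N) [Mono f] :
    Function.Injective (lin f) := by
  have h : kerι f = 0 := by
    rw [← cancel_mono f, kerι_comp, Limits.zero_comp]
  rw [← LinearMap.ker_eq_bot, LinearMap.ker_eq_bot']
  intro m hm
  exact LinearMap.congr_fun (congrArg lin h) ⟨m, hm⟩

theorem mono_of_injective {M N : RightComod R C} (f : M ⟶ N)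
    (hf : Function.Injective (lin f)) : Mono f :=
  ⟨fun _ _ h => hom_ext ((LinearMap.cancel_left hf).1 (congrArg lin h))⟩

end RightComod

end RightKernel

/-! ### Kernels and their transport along equivalences -/

section IsKernel

/-- `f` is a kernel of `g`. -/
structure IsKernel {A : Type*} [Category A] [Preadditive A] {K M N : A} (f : K ⟶ M) (g : M ⟶ N) :
    Prop where
  mono : Mono f
  comp_eq_zero : f ≫ g = 0
  exists_lift : ∀ {Z : A} (k : Z ⟶ M), k ≫ g = 0 → ∃ h : Z ⟶ K, h ≫ f = k

/-- A test object `Z` of `B` is isomorphic to an object in the image of `F`, and there fullness and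
faithfulness pull the lifting problem back to `A`. -/
theorem IsKernel.map {A B : Type*} [Category A] [Preadditive A] [Category B] [Preadditive B]
    (F : A ⥤ B) [F.Additive] [F.IsEquivalence] {K M N : A} {f : K ⟶ M} {g : M ⟶ N}
    (h : IsKernel f g) : IsKernel (F.map f) (F.map g) where
  mono := by
    have := h.mono
    infer_instance
  comp_eq_zero := by rw [← F.map_comp, h.comp_eq_zero, F.map_zero]
  exists_lift {Z} k hk := by
    obtain ⟨t, ht⟩ := h.exists_lift (F.preimage ((F.objObjPreimageIso Z).hom ≫ k))
      (F.map_injective (by simp [hk]))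
    refine ⟨(F.objObjPreimageIso Z).inv ≫ F.map t, ?_⟩
    rw [Category.assoc, ← F.map_comp, ht, F.map_preimage, Iso.inv_hom_id_assoc]

theorem IsKernel.of_iso {A : Type*} [Category A] [Preadditive A] {K M N K' M' N' : A}
    {f : K ⟶ M} {g : M ⟶ N} (h : IsKernel f g) {f' : K' ⟶ M'} {g' : M' ⟶ N'}
    (a : K' ⟶ K) (b : M' ⟶ M) (c : N' ⟶ N) [IsIso a] [IsIso b] [IsIso c]
    (hf : f' ≫ b = a ≫ f) (hg : g' ≫ c = b ≫ g) : IsKernel f' g' where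
  mono := by
    have := h.mono
    have : Mono (f' ≫ b) := by rw [hf]; infer_instance
    exact mono_of_mono f' b
  comp_eq_zero := by
    rw [← cancel_mono c, Category.assoc, hg, ← Category.assoc, hf, Category.assoc,
      h.comp_eq_zero, Limits.comp_zero, Limits.zero_comp]
  exists_lift k hk := by
    obtain ⟨t, ht⟩ := h.exists_lift (k ≫ b)
      (by rw [Category.assoc, ← hg, ← Category.assoc, hk, Limits.zero_comp])
    refine ⟨t ≫ inv a, ?_⟩
    rw [← cancel_mono b, Category.assoc, Category.assoc, hf, IsIso.inv_hom_id_assoc, ht]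

/-- The linear kernel of `g` is a legitimate test object because `C` is flat; lifting its inclusion
through `f` gives the preimages. -/
theorem IsKernel.exact {R C : Type u} [CommRing R] [AddCommGroup C] [Module R C]
    [Coalgebra R C] [Module.Flat R C] {K M N : RightComod R C} {f : K ⟶ M} {g : M ⟶ N}
    (h : IsKernel f g) : Function.Exact (RightComod.lin f) (RightComod.lin g) := by
  intro m
  constructor
  · intro hm
    obtain ⟨t, ht⟩ := h.exists_lift (RightComod.kerι g) (RightComod.kerι_comp g)
    exact ⟨RightComod.lin t ⟨m, hm⟩, LinearMap.congr_fun (congrArg RightComod.lin ht) ⟨m, hm⟩⟩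
  · rintro ⟨k, rfl⟩
    exact LinearMap.congr_fun (congrArg RightComod.lin h.comp_eq_zero) k

end IsKernel

/-! ### Tensoring with a module as a copower of comodules -/

section Copower

variable {R C : Type u} [CommRing R] [AddCommGroup C] [Module R C] [Coalgebra R C]
variable {W V : Type u} [AddCommGroup W] [Module R W] [AddCommGroup V] [Module R V]

/-- Uniqueness half of the copower property. It replaces element computations in later identities
between maps out of `W ⊗ M`. -/
theorem tensorRight_hom_ext {M N : RightComod R C} {f g : tensorRight W M ⟶ N}
    (h : ∀ w, insertion W M w ≫ f = insertion W M w ≫ g) : f = g :=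
  RightComod.hom_ext (TensorProduct.ext' fun w m =>
    LinearMap.congr_fun (congrArg RightComod.lin (h w)) m)

/-- The colinear map `W ⊗ M → N` corresponding to a linear map `W → Hom(M, N)`. -/
def tensorRightLift {M N : RightComod R C} (φ : W →ₗ[R] (M ⟶ N)) : tensorRight W M ⟶ N :=
  ⟨TensorProduct.lift (RightComod.linₗ _ _ ∘ₗ φ), by
    refine TensorProduct.ext' fun w m => ?_
    have h := LinearMap.congr_fun (RightComod.lin_colinear (φ w)) m
    have h2 : ∀ t : M.carrier ⊗[R] C,
        (TensorProduct.lift (RightComod.linₗ _ _ ∘ₗ φ)).rTensor C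
          ((TensorProduct.assoc R W M.carrier C).symm (w ⊗ₜ t)) =
        (RightComod.lin (φ w)).rTensor C t := by
      intro t
      induction t with
      | zero => simp
      | add a b ha hb => simp only [TensorProduct.tmul_add, map_add, ha, hb]
      | tmul m c => rfl
    exact h.trans (h2 _).symm⟩

/-- Existence half of the copower property, in the form used for rewriting. -/
theorem insertion_lift {M N : RightComod R C} (φ : W →ₗ[R] (M ⟶ N)) (w : W) :
    insertion W M w ≫ tensorRightLift φ = φ w := rfl

/-- `f ⊗ id_M` as a colinear map. -/
def tensorRightMap (f : W →ₗ[R] V) (M : RightComod R C) : tensorRight W M ⟶ tensorRight V M :=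
  tensorRightLift (insertion V M ∘ₗ f)

theorem lin_tensorRightMap (f : W →ₗ[R] V) (M : RightComod R C) :
    RightComod.lin (tensorRightMap f M) = f.rTensor M.carrier :=
  TensorProduct.ext' fun _ _ => rfl

theorem insertion_map (f : W →ₗ[R] V) (M : RightComod R C) (w : W) :
    insertion W M w ≫ tensorRightMap f M = insertion V M (f w) := rfl

variable (W) in
/-- `id_W ⊗ g` as a colinear map. -/
def tensorRightHom {M N : RightComod R C} (g : M ⟶ N) : tensorRight W M ⟶ tensorRight W N :=
  tensorRightLift (Linear.leftComp R _ g ∘ₗ insertion W N)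

theorem lin_tensorRightHom {M N : RightComod R C} (g : M ⟶ N) :
    RightComod.lin (tensorRightHom W g) = (RightComod.lin g).lTensor W :=
  TensorProduct.ext' fun _ _ => rfl

theorem insertion_hom {M N : RightComod R C} (g : M ⟶ N) (w : W) :
    insertion W M w ≫ tensorRightHom W g = g ≫ insertion W N w := rfl

theorem tensorRightHom_comp {M N P : RightComod R C} (f : M ⟶ N) (g : N ⟶ P) :
    tensorRightHom W (f ≫ g) = tensorRightHom W f ≫ tensorRightHom W g :=
  tensorRight_hom_ext fun _ => rfl

theorem tensorRightHom_id (M : RightComod R C) : tensorRightHom W (𝟙 M) = 𝟙 _ :=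
  tensorRight_hom_ext fun _ => rfl

instance {M N : RightComod R C} (f : M ⟶ N) [IsIso f] : IsIso (tensorRightHom W f) :=
  ⟨tensorRightHom W (inv f), by rw [← tensorRightHom_comp, IsIso.hom_inv_id, tensorRightHom_id],
    by rw [← tensorRightHom_comp, IsIso.inv_hom_id, tensorRightHom_id]⟩

variable (W V) in
/-- The associativity `W ⊗ (V ⊗ M) → (W ⊗ V) ⊗ M` as a colinear map. -/
def tensorRightAssoc (M : RightComod R C) :
    tensorRight W (tensorRight V M) ⟶ tensorRight (W ⊗[R] V) M :=
  tensorRightLift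
    { toFun := fun w => tensorRightLift (insertion (W ⊗[R] V) M ∘ₗ TensorProduct.mk R W V w)
      map_add' := fun a b => tensorRight_hom_ext fun v => by
        rw [Preadditive.comp_add]
        simp only [insertion_lift, map_add, LinearMap.comp_apply, LinearMap.add_apply]
      map_smul' := fun r a => tensorRight_hom_ext fun v => by
        rw [RingHom.id_apply, Linear.comp_smul]
        simp only [insertion_lift, map_smul, LinearMap.comp_apply, LinearMap.smul_apply] }

theorem insertion_insertion_assoc (M : RightComod R C) (w : W) (v : V) :
    insertion V M v ≫ insertion W (tensorRight V M) w ≫ tensorRightAssoc W V M =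
      insertion (W ⊗[R] V) M (w ⊗ₜ v) := rfl

theorem lin_tensorRightAssoc (M : RightComod R C) :
    RightComod.lin (tensorRightAssoc W V M) =
      (TensorProduct.assoc R W V M.carrier).symm.toLinearMap :=
  TensorProduct.ext' fun w t => LinearMap.congr_fun (f := RightComod.lin
    (insertion W (tensorRight V M) w ≫ tensorRightAssoc W V M))
    (g := (TensorProduct.assoc R W V M.carrier).symm.toLinearMap ∘ₗ TensorProduct.mk R W _ w)
    (TensorProduct.ext' fun _ _ => rfl) t

/-- The linear inverse of a colinear bijection is automatically colinear. -/
theorem isIso_of_bijective {M N : RightComod R C} (f : M ⟶ N)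
    (hf : Function.Bijective (RightComod.lin f)) : IsIso f := by
  let g := (LinearEquiv.ofBijective _ hf).symm.toLinearMap
  have h1 : RightComod.lin f ∘ₗ g = LinearMap.id :=
    LinearMap.ext fun x => (LinearEquiv.ofBijective _ hf).apply_symm_apply x
  have h2 : g ∘ₗ RightComod.lin f = LinearMap.id :=
    LinearMap.ext fun x => (LinearEquiv.ofBijective _ hf).symm_apply_apply x
  have hc := RightComod.lin_colinear f
  refine ⟨⟨g, ?_⟩, RightComod.hom_ext h2, RightComod.hom_ext h1⟩
  change _ = _
  calc M.coaction.map ∘ₗ g = (g ∘ₗ RightComod.lin f).rTensor C ∘ₗ M.coaction.map ∘ₗ g := by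
        rw [h2, LinearMap.rTensor_id, LinearMap.id_comp]
    _ = g.rTensor C ∘ₗ (N.coaction.map ∘ₗ RightComod.lin f) ∘ₗ g := by
        rw [hc, LinearMap.rTensor_comp]; rfl
    _ = g.rTensor C ∘ₗ N.coaction.map := by
        rw [LinearMap.comp_assoc, h1, LinearMap.comp_id]

instance (M : RightComod R C) : IsIso (tensorRightAssoc W V M) :=
  isIso_of_bijective _ (by
    rw [lin_tensorRightAssoc]; exact (TensorProduct.assoc R W V M.carrier).symm.bijective)

/-- The unit isomorphism `R ⊗ M → M` as a colinear map. -/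
def tensorRightUnit (M : RightComod R C) : tensorRight R M ⟶ M :=
  tensorRightLift (LinearMap.toSpanSingleton R _ (𝟙 M))

theorem insertion_unit (M : RightComod R C) (r : R) :
    insertion R M r ≫ tensorRightUnit M = r • 𝟙 M := rfl

theorem lin_tensorRightUnit (M : RightComod R C) :
    RightComod.lin (tensorRightUnit M) = (TensorProduct.lid R M.carrier).toLinearMap :=
  TensorProduct.ext' fun _ _ => rfl

/-- The coaction of `V` as a colinear map `V → V ⊗ C`. -/
def coactionHom (V : RightComod R C) : V ⟶ tensorRight V.carrier (regular R C) :=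
  ⟨V.coaction.map, by
    change (TensorProduct.assoc R V.carrier C C).symm.toLinearMap ∘ₗ
      (Coalgebra.comul (R := R) (A := C)).lTensor V.carrier ∘ₗ V.coaction.map = _
    rw [← V.coaction.coassoc]
    ext v
    simp⟩

theorem coactionHom_natural {V V' : RightComod R C} (f : V ⟶ V') :
    f ≫ coactionHom V' = coactionHom V ≫ tensorRightMap (RightComod.lin f) (regular R C) := by
  refine RightComod.hom_ext ?_
  rw [RightComod.lin_comp, RightComod.lin_comp, lin_tensorRightMap]
  exact RightComod.lin_colinear f

theorem coactionHom_tensorRight (V : RightComod R C) :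
    coactionHom (tensorRight W V) =
      tensorRightHom W (coactionHom V) ≫ tensorRightAssoc W V.carrier (regular R C) := by
  refine RightComod.hom_ext ?_
  rw [RightComod.lin_comp, lin_tensorRightHom, lin_tensorRightAssoc]
  rfl

/-- The difference of the two maps `ρ_V ⊗ id, id ⊗ Δ : V ⊗ C → V ⊗ C ⊗ C`. -/
def coactionDiff (V : RightComod R C) : tensorRight V.carrier (regular R C) ⟶
    tensorRight (V.carrier ⊗[R] C) (regular R C) :=
  tensorRightMap V.coaction.map (regular R C) -
    tensorRightHom V.carrier (comulHom R C) ≫ tensorRightAssoc V.carrier C (regular R C)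

/-- The counit splits the fork formed by `ρ_V`, `ρ_V ⊗ id` and `id ⊗ Δ`, so no flatness is needed.
-/
theorem isKernel_coactionHom (V : RightComod R C) :
    IsKernel (coactionHom V) (coactionDiff V) := by
  have hε : (TensorProduct.rid R V.carrier).toLinearMap ∘ₗ
    (Coalgebra.counit (R := R) (A := C)).lTensor V.carrier ∘ₗ V.coaction.map = LinearMap.id :=
    V.coaction.counit
  have hinj : Function.Injective V.coaction.map :=
    Function.LeftInverse.injective (g := (TensorProduct.rid R V.carrier).toLinearMap ∘ₗ
      (Coalgebra.counit (R := R) (A := C)).lTensor V.carrier) (LinearMap.congr_fun hε)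
  -- `ρ_V` has a linear retraction, so it stays injective after any tensor product.
  have hinj2 : Function.Injective (V.coaction.map.rTensor C) :=
    Function.LeftInverse.injective (g := ((TensorProduct.rid R V.carrier).toLinearMap ∘ₗ
      (Coalgebra.counit (R := R) (A := C)).lTensor V.carrier).rTensor C) (LinearMap.congr_fun (f :=
        LinearMap.rTensor C _ ∘ₗ LinearMap.rTensor C _) (g := LinearMap.id) (by
        rw [← LinearMap.rTensor_comp, LinearMap.comp_assoc, hε, LinearMap.rTensor_id]))
  have hlin : RightComod.lin (coactionDiff V) = V.coaction.map.rTensor C -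
      (TensorProduct.assoc R V.carrier C C).symm.toLinearMap ∘ₗ
        (Coalgebra.comul (R := R) (A := C)).lTensor V.carrier := by
    rw [coactionDiff, RightComod.lin_sub, RightComod.lin_comp, lin_tensorRightMap,
      lin_tensorRightHom, lin_tensorRightAssoc]
    rfl
  refine ⟨RightComod.mono_of_injective _ hinj, RightComod.hom_ext ?_, fun {Z} k hk => ?_⟩
  · rw [RightComod.lin_comp, hlin, LinearMap.sub_comp]
    refine sub_eq_zero.2 ?_
    exact (RightComod.lin_colinear (coactionHom V)).symm
  · have h1 : V.coaction.map.rTensor C ∘ₗ RightComod.lin k =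
        (TensorProduct.assoc R V.carrier C C).symm.toLinearMap ∘ₗ
        (Coalgebra.comul (R := R) (A := C)).lTensor V.carrier ∘ₗ RightComod.lin k := by
      have := congrArg RightComod.lin hk
      rw [RightComod.lin_comp, hlin, LinearMap.sub_comp] at this
      exact sub_eq_zero.1 this
    -- The lift is `(id ⊗ ε) ∘ k`. Applying `ε` to the last factor of `(ρ ⊗ id) k = (id ⊗ Δ) k`
    -- turns the left side into `ρ ∘ h` and the right side into `k`.
    let h : Z.carrier →ₗ[R] V.carrier := (TensorProduct.rid R V.carrier).toLinearMap ∘ₗ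
      (Coalgebra.counit (R := R) (A := C)).lTensor V.carrier ∘ₗ RightComod.lin k
    have key : V.coaction.map ∘ₗ h = RightComod.lin k := by
      have e1 : V.coaction.map ∘ₗ (TensorProduct.rid R V.carrier).toLinearMap ∘ₗ
          (Coalgebra.counit (R := R) (A := C)).lTensor V.carrier =
          (TensorProduct.rid R (V.carrier ⊗[R] C)).toLinearMap ∘ₗ
          (Coalgebra.counit (R := R) (A := C)).lTensor (V.carrier ⊗[R] C) ∘ₗ
          V.coaction.map.rTensor C := by
        ext v c; simp
      have e2 : (TensorProduct.rid R (V.carrier ⊗[R] C)).toLinearMap ∘ₗ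
          (Coalgebra.counit (R := R) (A := C)).lTensor (V.carrier ⊗[R] C) ∘ₗ
          (TensorProduct.assoc R V.carrier C C).symm.toLinearMap ∘ₗ
          (Coalgebra.comul (R := R) (A := C)).lTensor V.carrier = LinearMap.id := by
        refine TensorProduct.ext' fun v c => ?_
        have e3 : ∀ t : C ⊗[R] C, (TensorProduct.rid R (V.carrier ⊗[R] C))
            ((Coalgebra.counit (R := R) (A := C)).lTensor (V.carrier ⊗[R] C)
            ((TensorProduct.assoc R V.carrier C C).symm (v ⊗ₜ t))) =
            v ⊗ₜ (TensorProduct.rid R C) ((Coalgebra.counit (R := R) (A := C)).lTensor C t) := by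
          intro t
          induction t with
          | zero => simp
          | add a b ha hb => simp only [TensorProduct.tmul_add, map_add, ha, hb]
          | tmul m c => simp
        simp [e3]
      calc _ = (V.coaction.map ∘ₗ (TensorProduct.rid R V.carrier).toLinearMap ∘ₗ
          (Coalgebra.counit (R := R) (A := C)).lTensor V.carrier) ∘ₗ RightComod.lin k := rfl
        _ = (TensorProduct.rid R (V.carrier ⊗[R] C)).toLinearMap ∘ₗ
          (Coalgebra.counit (R := R) (A := C)).lTensor (V.carrier ⊗[R] C) ∘ₗ
          V.coaction.map.rTensor C ∘ₗ RightComod.lin k := by rw [e1]; rfl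
        _ = ((TensorProduct.rid R (V.carrier ⊗[R] C)).toLinearMap ∘ₗ
          (Coalgebra.counit (R := R) (A := C)).lTensor (V.carrier ⊗[R] C) ∘ₗ
          (TensorProduct.assoc R V.carrier C C).symm.toLinearMap ∘ₗ
          (Coalgebra.comul (R := R) (A := C)).lTensor V.carrier) ∘ₗ RightComod.lin k := by
            rw [h1]; rfl
        _ = RightComod.lin k := by rw [e2, LinearMap.id_comp]
    refine ⟨⟨h, ?_⟩, RightComod.hom_ext key⟩
    change V.coaction.map ∘ₗ h = h.rTensor C ∘ₗ Z.coaction.map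
    -- After composing with the injective `ρ_V ⊗ id`, colinearity of `h` becomes that of `k = ρ_V ∘
    -- h`.
    refine (LinearMap.cancel_left hinj2).1 ?_
    rw [← LinearMap.comp_assoc _ (h.rTensor C), ← LinearMap.rTensor_comp, key]
    refine Eq.trans ?_ (RightComod.lin_colinear k)
    rw [← key]
    exact congrArg (· ∘ₗ h) (RightComod.lin_colinear (coactionHom V)).symm

end Copower

/-! ### The maps `λ` and the left coaction on `F(C)` -/

section Lambda

variable {R C D : Type u} [CommRing R] [AddCommGroup C] [Module R C] [Coalgebra R C]
  [AddCommGroup D] [Module R D] [Coalgebra R D]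
  (F : RightComod R C ⥤ RightComod R D) [F.Additive] [F.Linear R]
variable (W V : Type u) [AddCommGroup W] [Module R W] [AddCommGroup V] [Module R V]

/-- The map `λ_{W,M}` as a colinear map. -/
def lamHom (M : RightComod R C) : tensorRight W (F.obj M) ⟶ F.obj (tensorRight W M) :=
  tensorRightLift (F.mapLinearMap R ∘ₗ insertion W M)

variable {W V}

theorem insertion_lamHom (M : RightComod R C) (w : W) :
    insertion W (F.obj M) w ≫ lamHom F W M = F.map (insertion W M w) := rfl

theorem map_lamHom (f : W →ₗ[R] V) (M : RightComod R C) :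
    tensorRightMap f (F.obj M) ≫ lamHom F V M = lamHom F W M ≫ F.map (tensorRightMap f M) :=
  tensorRight_hom_ext fun w => by
    rw [← Category.assoc, ← Category.assoc, insertion_map, insertion_lamHom, insertion_lamHom,
      ← F.map_comp, insertion_map]

theorem hom_lamHom {M N : RightComod R C} (g : M ⟶ N) :
    tensorRightHom W (F.map g) ≫ lamHom F W N = lamHom F W M ≫ F.map (tensorRightHom W g) :=
  tensorRight_hom_ext fun w => by
    rw [← Category.assoc, ← Category.assoc, insertion_hom, Category.assoc, insertion_lamHom,
      insertion_lamHom, ← F.map_comp, ← F.map_comp, insertion_hom]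

/-- Coherence of `λ` with associativity; with `unit_lamHom` and naturality it transfers the
coalgebra axioms from `C` to `F(C)`. -/
theorem assoc_lamHom (M : RightComod R C) :
    tensorRightAssoc W V (F.obj M) ≫ lamHom F (W ⊗[R] V) M =
      tensorRightHom W (lamHom F V M) ≫ lamHom F W (tensorRight V M) ≫
        F.map (tensorRightAssoc W V M) :=
  tensorRight_hom_ext fun w => tensorRight_hom_ext fun v => by
    have h1 := congrArg (· ≫ lamHom F (W ⊗[R] V) M) (insertion_insertion_assoc (F.obj M) w v)
    simp only [Category.assoc] at h1
    rw [h1, insertion_lamHom, ← Category.assoc (insertion W _ w), insertion_hom,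
      Category.assoc, ← Category.assoc (insertion W _ w), insertion_lamHom, ← Category.assoc,
      insertion_lamHom, ← F.map_comp, ← F.map_comp, insertion_insertion_assoc]

theorem unit_lamHom (M : RightComod R C) :
    lamHom F R M ≫ F.map (tensorRightUnit M) = tensorRightUnit (F.obj M) :=
  tensorRight_hom_ext fun r => by
    rw [← Category.assoc, insertion_lamHom, ← F.map_comp, insertion_unit, insertion_unit,
      F.map_smul, F.map_id]

/-- An equivalence carries the copower `W ⊗ M` to a copower of `F(M)`, and `λ` is the comparison
with the copower `W ⊗ F(M)`. -/
instance [F.IsEquivalence] (M : RightComod R C) : IsIso (lamHom F W M) := by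
  -- The inverse is a map `F(W ⊗ M) → W ⊗ F(M)`. Its target is replaced by some `F(L)`, so that it
  -- can be built in `M^C` from the universal property of `W ⊗ M`.
  let L := F.objPreimage (tensorRight W (F.obj M))
  let i : F.obj L ≅ tensorRight W (F.obj M) := F.objObjPreimageIso _
  let φ : W →ₗ[R] (M ⟶ L) :=
    { toFun := fun w => F.preimage (insertion W (F.obj M) w ≫ i.inv)
      map_add' := fun a b => F.map_injective (by
        rw [F.map_add, F.map_preimage, F.map_preimage, F.map_preimage, map_add,
          Preadditive.add_comp])
      map_smul' := fun r a => F.map_injective (by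
        rw [RingHom.id_apply, F.map_smul, F.map_preimage, F.map_preimage, map_smul,
          Linear.smul_comp]) }
  have hφ : ∀ w, F.map (φ w) = insertion W (F.obj M) w ≫ i.inv := fun w => F.map_preimage _
  let μ := F.map (tensorRightLift φ) ≫ i.hom
  have h1 : lamHom F W M ≫ μ = 𝟙 _ := tensorRight_hom_ext fun w => by
    rw [← Category.assoc, insertion_lamHom, ← Category.assoc, ← F.map_comp, insertion_lift, hφ,
      Category.assoc, Iso.inv_hom_id]
  refine ⟨μ, h1, ?_⟩
  -- Maps out of `F(W ⊗ M)` are not yet known to be determined by insertions, so the endomorphism is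
  -- lifted to `W ⊗ M`, where they are.
  obtain ⟨t, ht⟩ := F.map_surjective (μ ≫ lamHom F W M)
  rw [← ht, ← F.map_id]
  congr 1
  refine tensorRight_hom_ext fun w => F.map_injective ?_
  rw [F.map_comp, ht, ← insertion_lamHom, Category.assoc, reassoc_of% h1, Category.comp_id,
    insertion_lamHom]

theorem lam_bijective [F.IsEquivalence] (M : RightComod R C) :
    Function.Bijective (lam F W M) :=
  RightComod.bijective_lin (lamHom F W M)

/-- The left coaction `λ⁻¹ ∘ F(Δ)` on `F(C)` as a right colinear map. -/
noncomputable def leftHom [F.IsEquivalence] :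
    F.obj (regular R C) ⟶ tensorRight C (F.obj (regular R C)) :=
  F.map (comulHom R C) ≫ inv (lamHom F C (regular R C))

theorem leftHom_lamHom [F.IsEquivalence] :
    leftHom F ≫ lamHom F C (regular R C) = F.map (comulHom R C) := by
  rw [leftHom, Category.assoc, IsIso.inv_hom_id, Category.comp_id]

/-- The computation shared by coassociativity (`g = Δ`), the balancing map (`g = Δ`) and the unit
(`g` a coaction): along `λ`, tensoring `λ⁻¹ ∘ F(g)` with `W` becomes `F(id_W ⊗ g)`. -/
theorem tensorRightHom_inv_lamHom_assoc [F.IsEquivalence] {M N : RightComod R C}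
    (g : M ⟶ tensorRight V N) :
    (tensorRightHom W (F.map g ≫ inv (lamHom F V N)) ≫ tensorRightAssoc W V (F.obj N)) ≫
      lamHom F (W ⊗[R] V) N =
    lamHom F W M ≫ F.map (tensorRightHom W g ≫ tensorRightAssoc W V N) := by
  rw [Category.assoc, assoc_lamHom, ← Category.assoc, ← tensorRightHom_comp, Category.assoc,
    IsIso.inv_hom_id, Category.comp_id, ← Category.assoc, hom_lamHom, Category.assoc, F.map_comp]

/-- After cancelling the isomorphism `λ` for `C ⊗ C`, both sides are `F` applied to the two sides of
the coassociativity of `Δ`. -/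
theorem leftHom_coassoc [F.IsEquivalence] :
    leftHom F ≫ tensorRightHom C (leftHom F) ≫ tensorRightAssoc C C _ =
      leftHom F ≫ tensorRightMap (Coalgebra.comul (R := R)) _ := by
  have h : comulHom R C ≫ tensorRightHom C (comulHom R C) ≫ tensorRightAssoc C C (regular R C) =
      comulHom R C ≫ tensorRightMap (Coalgebra.comul (R := R)) (regular R C) := by
    refine RightComod.hom_ext ?_
    rw [RightComod.lin_comp, RightComod.lin_comp, RightComod.lin_comp, lin_tensorRightHom,
      lin_tensorRightAssoc, lin_tensorRightMap]
    exact RightComod.lin_colinear (comulHom R C)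
  rw [← cancel_mono (lamHom F (C ⊗[R] C) (regular R C)), Category.assoc]
  refine (congrArg (leftHom F ≫ ·) (tensorRightHom_inv_lamHom_assoc F (comulHom R C))).trans ?_
  rw [← Category.assoc, leftHom_lamHom, Category.assoc, map_lamHom, ← Category.assoc,
    leftHom_lamHom, ← F.map_comp, ← F.map_comp, h]

theorem leftHom_counit [F.IsEquivalence] :
    leftHom F ≫ tensorRightMap (Coalgebra.counit (R := R)) _ ≫ tensorRightUnit _ = 𝟙 _ := by
  have h : comulHom R C ≫ tensorRightMap (Coalgebra.counit (R := R)) (regular R C) ≫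
      tensorRightUnit _ = 𝟙 _ := by
    refine RightComod.hom_ext ?_
    rw [RightComod.lin_comp, RightComod.lin_comp, lin_tensorRightMap, lin_tensorRightUnit]
    refine LinearMap.ext fun c => ?_
    change TensorProduct.lid R C ((Coalgebra.counit (R := R) (A := C)).rTensor C
      (Coalgebra.comul c)) = c
    simp
  rw [← unit_lamHom, ← Category.assoc (tensorRightMap _ _), map_lamHom, Category.assoc,
    ← Category.assoc, leftHom_lamHom, ← F.map_comp, ← F.map_comp, h, F.map_id]

/-- The left coaction `λ⁻¹ ∘ F(Δ)` on `F(C)`. -/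
noncomputable def leftCoaction [F.IsEquivalence] :
    LeftCoaction R C (F.obj (regular R C)).carrier where
  map := RightComod.lin (leftHom F)
  coassoc := by
    have h := congrArg RightComod.lin (leftHom_coassoc F)
    rw [RightComod.lin_comp, RightComod.lin_comp, RightComod.lin_comp, lin_tensorRightHom,
      lin_tensorRightAssoc, lin_tensorRightMap] at h
    refine LinearMap.ext fun x => ?_
    have hx := LinearMap.congr_fun h x
    exact (LinearEquiv.symm_apply_eq (TensorProduct.assoc R C C _)).1 hx
  counit := by
    have h := congrArg RightComod.lin (leftHom_counit F)
    rw [RightComod.lin_comp, RightComod.lin_comp, lin_tensorRightMap, lin_tensorRightUnit] at h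
    exact h

theorem lam_leftCoaction [F.IsEquivalence] :
    lam F C (regular R C) ∘ₗ (leftCoaction F).map = RightComod.lin (F.map (comulHom R C)) :=
  congrArg RightComod.lin (leftHom_lamHom F)

/-- The coaction was built as a morphism of `M^D`, and its colinearity is the compatibility
condition itself. -/
theorem leftCoaction_compatible [F.IsEquivalence] :
    Compatible (leftCoaction F) (F.obj (regular R C)).coaction :=
  RightComod.lin_colinear (leftHom F)

/-- The functor `- ⊗ F(C)` is isomorphic to `F(- ⊗ C)`. Flatness of `C` makes `f ⊗ C` a
monomorphism, `F` preserves it, and flatness of `D` makes the resulting monomorphism injective. -/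
theorem flat_obj_regular [F.IsEquivalence] [Module.Flat R C] [Module.Flat R D] :
    Module.Flat R (F.obj (regular R C)).carrier := by
  refine Module.Flat.iff_rTensor_preserves_injective_linearMap.2 fun W V _ _ _ _ f hf => ?_
  have : Mono (tensorRightMap f (regular R C)) := RightComod.mono_of_injective _ (by
    rw [lin_tensorRightMap]
    exact Module.Flat.rTensor_preserves_injective_linearMap f hf)
  have h : tensorRightMap f (F.obj (regular R C)) = lamHom F W _ ≫
      F.map (tensorRightMap f (regular R C)) ≫ inv (lamHom F V _) := by
    rw [← Category.assoc, ← map_lamHom, Category.assoc, IsIso.hom_inv_id, Category.comp_id]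
  have : Mono (tensorRightMap f (F.obj (regular R C))) := by rw [h]; infer_instance
  rw [← lin_tensorRightMap]
  exact RightComod.injective_of_mono _

end Lambda

/-! ### The isomorphism of `C` with `F(C) □ G(D)` -/

section Unit

variable {R C D : Type u} [CommRing R] [AddCommGroup C] [Module R C] [Coalgebra R C]
  [AddCommGroup D] [Module R D] [Coalgebra R D]
  (F : RightComod R C ⥤ RightComod R D)
  (G : RightComod R D ⥤ RightComod R C) [G.Additive] [G.Linear R] [G.IsEquivalence]
  (η : 𝟭 (RightComod R C) ≅ F ⋙ G)

/-- The map `C → F(C) ⊗ G(D)` with image `F(C) □ G(D)`. -/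
noncomputable def unitHom :
    regular R C ⟶ tensorRight (F.obj (regular R C)).carrier (G.obj (regular R D)) :=
  η.hom.app (regular R C) ≫ G.map (coactionHom (F.obj (regular R C))) ≫ inv (lamHom G _ _)

theorem tensorRightHom_unitHom (W : Type u) [AddCommGroup W] [Module R W] :
    (tensorRightHom W (unitHom F G η) ≫ tensorRightAssoc W _ _) ≫ lamHom G _ _ =
      (tensorRightHom W (η.hom.app (regular R C)) ≫ lamHom G W (F.obj (regular R C))) ≫
        G.map (coactionHom (tensorRight W (F.obj (regular R C)))) := by
  rw [unitHom, tensorRightHom_comp, Category.assoc, Category.assoc,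
    ← Category.assoc (tensorRightHom W _) (tensorRightAssoc W _ _),
    tensorRightHom_inv_lamHom_assoc, coactionHom_tensorRight, Category.assoc]

/-- The map `ρ_V ⊗ id - id ⊗ ρ_{G(D)} : V ⊗ G(D) → V ⊗ D ⊗ G(D)` as a right `C`-colinear map. -/
noncomputable def balancingHom (V : RightComod R D) :
    tensorRight V.carrier (G.obj (regular R D)) ⟶
      tensorRight (V.carrier ⊗[R] D) (G.obj (regular R D)) :=
  tensorRightMap V.coaction.map _ - tensorRightHom V.carrier (leftHom G) ≫ tensorRightAssoc _ _ _

/-- Along `λ`, the map defining `V □ G(D)` is `G` of the map whose kernel is `V`. -/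
theorem balancingHom_lamHom (V : RightComod R D) :
    balancingHom G V ≫ lamHom G _ _ = lamHom G _ _ ≫ G.map (coactionDiff V) := by
  rw [balancingHom, coactionDiff, G.map_sub, Preadditive.sub_comp, Preadditive.comp_sub,
    map_lamHom]
  congr 1
  exact tensorRightHom_inv_lamHom_assoc G (comulHom R D)

/-- `G` preserves the kernel presentation of `W ⊗ F(C)`; the maps `λ` and `η` rewrite its image.
Allowing an arbitrary `W` is what yields purity of the cotensor product. -/
theorem isKernel_unitHom (W : Type u) [AddCommGroup W] [Module R W] :
    IsKernel (tensorRightHom W (unitHom F G η) ≫ tensorRightAssoc W _ _)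
      (balancingHom G (tensorRight W (F.obj (regular R C)))) :=
  ((isKernel_coactionHom (tensorRight W (F.obj (regular R C)))).map G).of_iso
    (tensorRightHom W (η.hom.app (regular R C)) ≫ lamHom G W (F.obj (regular R C)))
    (lamHom G _ _) (lamHom G _ _) (tensorRightHom_unitHom F G η W) (balancingHom_lamHom G _)

variable [F.Additive] [F.Linear R]

omit [G.IsEquivalence] in
-- On each insertion this is naturality of `η`.
theorem unit_lamHom_lamHom (W : Type u) [AddCommGroup W] [Module R W] (M : RightComod R C) :
    tensorRightHom W (η.hom.app M) ≫ lamHom G W (F.obj M) ≫ G.map (lamHom F W M) =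
      η.hom.app (tensorRight W M) :=
  tensorRight_hom_ext fun w => by
    have h := η.hom.naturality (insertion W M w)
    rw [Functor.id_map, Functor.comp_map] at h
    refine Eq.trans ?_ h.symm
    change η.hom.app M ≫ G.map (insertion W (F.obj M) w) ≫ G.map (lamHom F W M) = _
    rw [← G.map_comp, insertion_lamHom]

/-- Left colinearity of the unit combines naturality of `η` at `Δ` with the fact that `leftHom F`
respects right coactions. -/
theorem unitHom_left [F.IsEquivalence] :
    unitHom F G η ≫ tensorRightMap (leftCoaction F).map (G.obj (regular R D)) =
      comulHom R C ≫ tensorRightHom C (unitHom F G η) ≫ tensorRightAssoc C _ _ := by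
  have h1 : η.hom.app (regular R C) ≫ G.map (leftHom F) =
      comulHom R C ≫ tensorRightHom C (η.hom.app (regular R C)) ≫
        lamHom G C (F.obj (regular R C)) := by
    have := η.hom.naturality (comulHom R C)
    rw [Functor.id_map, Functor.comp_map] at this
    rw [leftHom, G.map_comp, ← Category.assoc, ← this, Category.assoc, ← unit_lamHom_lamHom,
      Category.assoc, Category.assoc, ← G.map_comp, IsIso.hom_inv_id, G.map_id, Category.comp_id]
  rw [← cancel_mono (lamHom G _ _), Category.assoc (comulHom R C), tensorRightHom_unitHom,
    Category.assoc, map_lamHom, unitHom, Category.assoc, Category.assoc, IsIso.inv_hom_id_assoc,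
    ← G.map_comp]
  have h2 := coactionHom_natural (leftHom F)
  refine (congrArg (fun t => η.hom.app (regular R C) ≫ G.map t) h2.symm).trans ?_
  rw [G.map_comp, ← Category.assoc, h1]
  simp only [Category.assoc]

end Unit

/-! ### Left comodules and `N ≅ C □ N` -/

namespace LeftComod

variable {R C : Type u} [CommRing R] [AddCommGroup C] [Module R C] [Coalgebra R C]

theorem hom_ext {M N : LeftComod R C} {f g : M ⟶ N} (h : lin f = lin g) : f = g :=
  Subtype.ext h

theorem lin_colinear {M N : LeftComod R C} (f : M ⟶ N) :
    N.coaction.map ∘ₗ lin f = (lin f).lTensor C ∘ₗ M.coaction.map := f.2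

/-- A bijective colinear map of left comodules is an isomorphism. -/
noncomputable def isoOfLinearEquiv {M N : LeftComod R C} (e : M.carrier ≃ₗ[R] N.carrier)
    (he : N.coaction.map ∘ₗ e.toLinearMap = e.toLinearMap.lTensor C ∘ₗ M.coaction.map) :
    M ≅ N where
  hom := ⟨e.toLinearMap, he⟩
  inv := ⟨e.symm.toLinearMap, by
    change _ = _
    calc M.coaction.map ∘ₗ e.symm.toLinearMap =
          (e.symm.toLinearMap ∘ₗ e.toLinearMap).lTensor C ∘ₗ M.coaction.map ∘ₗ
            e.symm.toLinearMap := by simp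
      _ = e.symm.toLinearMap.lTensor C ∘ₗ (N.coaction.map ∘ₗ e.toLinearMap) ∘ₗ
            e.symm.toLinearMap := by rw [he, LinearMap.lTensor_comp]; rfl
      _ = e.symm.toLinearMap.lTensor C ∘ₗ N.coaction.map := by
          rw [LinearMap.comp_assoc]; simp⟩
  hom_inv_id := hom_ext (LinearMap.ext e.symm_apply_apply)
  inv_hom_id := hom_ext (LinearMap.ext e.apply_symm_apply)

theorem coaction_injective (N : LeftComod R C) : Function.Injective N.coaction.map :=
  Function.LeftInverse.injective (g := (TensorProduct.lid R N.carrier).toLinearMap ∘ₗ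
    (Coalgebra.counit (R := R) (A := C)).rTensor N.carrier) (LinearMap.congr_fun N.coaction.counit)

/-- Left-handed version of the counit splitting: an `s` in `C □ N` is the coaction of `(ε ⊗ id) s`.
-/
theorem exact_coaction (N : LeftComod R C) :
    Function.Exact N.coaction.map (cotensorMap (regular R C) N) := by
  intro s
  constructor
  · intro hs
    refine ⟨TensorProduct.lid R N.carrier ((Coalgebra.counit (R := R) (A := C)).rTensor _ s), ?_⟩
    have h1 : N.coaction.map ∘ₗ (TensorProduct.lid R N.carrier).toLinearMap ∘ₗ
        (Coalgebra.counit (R := R) (A := C)).rTensor N.carrier =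
        (TensorProduct.lid R (C ⊗[R] N.carrier)).toLinearMap ∘ₗ
        (Coalgebra.counit (R := R) (A := C)).rTensor (C ⊗[R] N.carrier) ∘ₗ
        N.coaction.map.lTensor C := by
      ext c n; simp
    have h2 : (TensorProduct.lid R (C ⊗[R] N.carrier)).toLinearMap ∘ₗ
        (Coalgebra.counit (R := R) (A := C)).rTensor (C ⊗[R] N.carrier) ∘ₗ
        (TensorProduct.assoc R C C N.carrier).toLinearMap ∘ₗ
        (Coalgebra.comul (R := R) (A := C)).rTensor N.carrier = LinearMap.id := by
      refine TensorProduct.ext' fun c n => ?_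
      have h3 : ∀ t : C ⊗[R] C, TensorProduct.lid R (C ⊗[R] N.carrier)
          ((Coalgebra.counit (R := R) (A := C)).rTensor (C ⊗[R] N.carrier)
          (TensorProduct.assoc R C C N.carrier (t ⊗ₜ n))) =
          TensorProduct.lid R C ((Coalgebra.counit (R := R) (A := C)).rTensor C t) ⊗ₜ n := by
        intro t
        induction t with
        | zero => simp
        | add a b ha hb => simp only [TensorProduct.add_tmul, map_add, ha, hb]
        | tmul a b => simp [TensorProduct.smul_tmul']
      simp [h3]
    have hs' : TensorProduct.assoc R C C N.carrier
        ((Coalgebra.comul (R := R) (A := C)).rTensor N.carrier s) = N.coaction.map.lTensor C s :=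
      sub_eq_zero.1 hs
    have e1 := LinearMap.congr_fun h1 s
    have e2 := LinearMap.congr_fun h2 s
    simp only [LinearMap.comp_apply, LinearEquiv.coe_coe, LinearMap.id_apply] at e1 e2
    rw [e1, ← hs', e2]
  · rintro ⟨n, rfl⟩
    exact sub_eq_zero.2 (LinearMap.congr_fun N.coaction.coassoc n).symm

end LeftComod

/-! ### Iterated cotensor products -/

section CotensorComp

variable {R C D : Type u} [CommRing R] [AddCommGroup C] [Module R C] [Coalgebra R C]
  [AddCommGroup D] [Module R D] [Coalgebra R D]

/-- The left comodule underlying a bicomodule. -/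
abbrev Bicomod.toLeft (Y : Bicomod R D C) : LeftComod R D where
  carrier := Y.right.carrier
  coaction := Y.left

/-- The left comodule `Y ⊗ V` of a bicomodule `Y` and a module `V`. -/
abbrev Bicomod.tensorLeft (Y : Bicomod R D C) (V : Type u) [AddCommGroup V] [Module R V] :
    LeftComod R D where
  carrier := Y.right.carrier ⊗[R] V
  coaction := Y.left.tensor V

theorem cotensorMap_tensorLeft (X : RightComod R D) (Y : Bicomod R D C) (V : Type u)
    [AddCommGroup V] [Module R V] :
    cotensorMap X (Y.tensorLeft V) ∘ₗ (TensorProduct.assoc R _ _ V).toLinearMap =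
      ((TensorProduct.assoc R _ _ V).toLinearMap.lTensor X.carrier ∘ₗ
        (TensorProduct.assoc R _ _ V).toLinearMap) ∘ₗ (cotensorMap X Y.toLeft).rTensor V := by
  rw [cotensorMap, cotensorMap, LinearMap.rTensor_sub, LinearMap.sub_comp, LinearMap.comp_sub]
  congr 1
  · ext x y v
    simp only [TensorProduct.AlgebraTensorModule.curry_apply, TensorProduct.curry_apply,
      LinearMap.coe_restrictScalars, LinearMap.comp_apply, LinearEquiv.coe_coe,
      LinearMap.rTensor_tmul, TensorProduct.assoc_tmul]
    generalize X.coaction.map x = s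
    induction s with
    | zero => simp
    | add a b ha hb => simp only [TensorProduct.add_tmul, map_add, ha, hb]
    | tmul a b => simp
  · ext x y v
    simp [LeftCoaction.tensor]

/-- For a `C`-`D`-bicomodule `X` and a `D`-`C`-bicomodule `Y`, the linear map
`α : C → X ⊗ Y` is a bicolinear isomorphism onto `X □ Y`, stably under tensor
products. -/
structure IsCotensorUnit (X : Bicomod R C D) (Y : Bicomod R D C)
    (α : C →ₗ[R] X.right.carrier ⊗[R] Y.right.carrier) : Prop where
  left : X.left.map.rTensor Y.right.carrier ∘ₗ α =
    (TensorProduct.assoc R C X.right.carrier Y.right.carrier).symm.toLinearMap ∘ₗ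
      α.lTensor C ∘ₗ Coalgebra.comul
  right : (TensorProduct.assoc R X.right.carrier Y.right.carrier C).symm.toLinearMap ∘ₗ
    Y.right.coaction.map.lTensor X.right.carrier ∘ₗ α = α.rTensor C ∘ₗ Coalgebra.comul
  injective : ∀ (V : Type u) [AddCommGroup V] [Module R V], Function.Injective (α.rTensor V)
  exact : ∀ (V : Type u) [AddCommGroup V] [Module R V],
    Function.Exact (α.rTensor V) ((cotensorMap X.right Y.toLeft).rTensor V)

/-- The inclusion `X □ (Y □ N) → X ⊗ (Y ⊗ N)`. -/
noncomputable def cotensorIncl [Module.Flat R D] (X : RightComod R D) (Y : Bicomod R D C)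
    (N : LeftComod R C) :
    cotensor X (cotensorObj Y N) →ₗ[R] X.carrier ⊗[R] (Y.right.carrier ⊗[R] N.carrier) :=
  (cotensor Y.right N).subtype.lTensor X.carrier ∘ₗ (cotensor X (cotensorObj Y N)).subtype

theorem cotensorIncl_injective [Module.Flat R D] (X : RightComod R D) [Module.Flat R X.carrier]
    (Y : Bicomod R D C) (N : LeftComod R C) : Function.Injective (cotensorIncl X Y N) :=
  (lTensor_subtype_injective (C := X.carrier) (cotensor Y.right N)).comp
    (Submodule.injective_subtype _)

/-- The inclusion `Y □ N → Y ⊗ N` as a colinear map. -/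
noncomputable def cotensorι [Module.Flat R D] (Y : Bicomod R D C) (N : LeftComod R C) :
    cotensorObj Y N ⟶ Y.tensorLeft N.carrier :=
  ⟨(cotensor Y.right N).subtype, (lTensor_comp_kerMap _ _ _ (cotensorMap_colinear Y N)).symm⟩

/-- Flatness of `X` makes `X ⊗ (Y □ N)` the kernel of the first condition; flatness of `X` and `D`
keeps `X ⊗ D ⊗ (Y □ N)` embedded, so the second condition can be tested in `X ⊗ D ⊗ Y ⊗ N`. -/
theorem mem_range_cotensorIncl [Module.Flat R D] (X : RightComod R D) [Module.Flat R X.carrier]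
    (Y : Bicomod R D C) (N : LeftComod R C)
    (t : X.carrier ⊗[R] (Y.right.carrier ⊗[R] N.carrier)) :
    t ∈ LinearMap.range (cotensorIncl X Y N) ↔
      (cotensorMap Y.right N).lTensor X.carrier t = 0 ∧
        cotensorMap X (Y.tensorLeft N.carrier) t = 0 := by
  have hex := Module.Flat.lTensor_exact X.carrier (f := (cotensor Y.right N).subtype)
    (g := cotensorMap Y.right N) (LinearMap.exact_subtype_ker_map _)
  have hn : ∀ u, cotensorMap X (Y.tensorLeft N.carrier)
        ((cotensor Y.right N).subtype.lTensor X.carrier u) =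
      ((cotensor Y.right N).subtype.lTensor D).lTensor X.carrier
        (cotensorMap X (cotensorObj Y N) u) :=
    LinearMap.congr_fun (cotensorMap_natural X (cotensorι Y N))
  have hinj : Function.Injective (((cotensor Y.right N).subtype.lTensor D).lTensor X.carrier) :=
    Module.Flat.lTensor_preserves_injective_linearMap _ (lTensor_subtype_injective _)
  constructor
  · rintro ⟨u, rfl⟩
    refine ⟨(hex _).2 ⟨u.1, rfl⟩, (hn u.1).trans ?_⟩
    rw [LinearMap.mem_ker.1 u.2, map_zero]
  · rintro ⟨h1, h2⟩
    obtain ⟨u, rfl⟩ := (hex t).1 h1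
    refine ⟨⟨u, hinj ?_⟩, rfl⟩
    rw [← hn, h2, map_zero]

namespace IsCotensorUnit

variable {X : Bicomod R C D} {Y : Bicomod R D C}
    {α : C →ₗ[R] X.right.carrier ⊗[R] Y.right.carrier}

/-- The map `N → X ⊗ (Y ⊗ N)` induced by `α : C → X ⊗ Y`. -/
def unitMap (α : C →ₗ[R] X.right.carrier ⊗[R] Y.right.carrier) (N : LeftComod R C) :
    N.carrier →ₗ[R] X.right.carrier ⊗[R] (Y.right.carrier ⊗[R] N.carrier) :=
  (TensorProduct.assoc R _ _ _).toLinearMap ∘ₗ α.rTensor N.carrier ∘ₗ N.coaction.map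

theorem unitMap_injective (h : IsCotensorUnit X Y α) (N : LeftComod R C) :
    Function.Injective (unitMap α N) :=
  (TensorProduct.assoc R _ _ _).injective.comp ((h.injective _).comp N.coaction_injective)

/-- Right colinearity of `α` matches the terms with the coactions of `Y` and `C`; the terms with the
coaction of `N` agree since they act on separate factors. -/
theorem lTensor_cotensorMap (h : IsCotensorUnit X Y α) (N : LeftComod R C) :
    (cotensorMap Y.right N).lTensor X.right.carrier ∘ₗ (TensorProduct.assoc R _ _ _).toLinearMap ∘ₗ
      α.rTensor N.carrier = (TensorProduct.assoc R _ _ _).toLinearMap ∘ₗ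
        α.rTensor (C ⊗[R] N.carrier) ∘ₗ cotensorMap (regular R C) N := by
  rw [cotensorMap, cotensorMap, LinearMap.lTensor_sub, LinearMap.sub_comp, LinearMap.comp_sub,
    LinearMap.comp_sub]
  congr 1
  · refine TensorProduct.ext' fun c n => ?_
    have hr := LinearMap.congr_fun h.right c
    simp only [LinearMap.comp_apply, LinearEquiv.coe_coe] at hr
    have h1 : ∀ t : X.right.carrier ⊗[R] Y.right.carrier,
        ((TensorProduct.assoc R Y.right.carrier C N.carrier).toLinearMap ∘ₗ
          Y.right.coaction.map.rTensor N.carrier).lTensor X.right.carrier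
          (TensorProduct.assoc R _ _ _ (t ⊗ₜ n)) =
        TensorProduct.assoc R _ _ _ (TensorProduct.assoc R _ _ _
          ((TensorProduct.assoc R X.right.carrier Y.right.carrier C).symm
            (Y.right.coaction.map.lTensor X.right.carrier t) ⊗ₜ n)) := by
      intro t
      induction t with
      | zero => simp
      | add a b ha hb => simp only [TensorProduct.add_tmul, map_add, ha, hb]
      | tmul x y =>
        simp only [TensorProduct.assoc_tmul, LinearMap.lTensor_tmul, LinearMap.comp_apply,
          LinearMap.rTensor_tmul, LinearEquiv.coe_coe]
        generalize Y.right.coaction.map y = s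
        induction s with
        | zero => simp
        | add a b ha hb => simp only [TensorProduct.add_tmul, TensorProduct.tmul_add, map_add, ha, hb]
        | tmul a b => simp
    have h2 : ∀ t : C ⊗[R] C, TensorProduct.assoc R _ _ _ (TensorProduct.assoc R _ _ _
          (α.rTensor C t ⊗ₜ n)) = TensorProduct.assoc R _ _ _ (α.rTensor (C ⊗[R] N.carrier)
          (TensorProduct.assoc R _ _ _ (t ⊗ₜ[R] n))) := by
      intro t
      induction t with
      | zero => simp
      | add a b ha hb => simp only [TensorProduct.add_tmul, map_add, ha, hb]
      | tmul a b => simp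
    simp only [LinearMap.comp_apply, LinearMap.rTensor_tmul, LinearEquiv.coe_coe]
    rw [← h2, ← hr, ← h1]
  · refine TensorProduct.ext' fun c n => ?_
    simp only [LinearMap.comp_apply, LinearMap.rTensor_tmul, LinearMap.lTensor_tmul,
      LinearEquiv.coe_coe]
    generalize α c = t
    induction t with
    | zero => simp
    | add a b ha hb => simp only [TensorProduct.add_tmul, map_add, ha, hb]
    | tmul a b => simp

/-- The same two conditions that cut out `X □ (Y □ N)` cut out the image of `N`. This replaces
associativity of the cotensor product. -/
theorem mem_range_unitMap (h : IsCotensorUnit X Y α) (N : LeftComod R C)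
    (t : X.right.carrier ⊗[R] (Y.right.carrier ⊗[R] N.carrier)) :
    t ∈ LinearMap.range (unitMap α N) ↔
      (cotensorMap Y.right N).lTensor X.right.carrier t = 0 ∧
        cotensorMap X.right (Y.tensorLeft N.carrier) t = 0 := by
  have k1 := LinearMap.congr_fun (h.lTensor_cotensorMap N)
  have k2 := LinearMap.congr_fun (cotensorMap_tensorLeft X.right Y N.carrier)
  simp only [LinearMap.comp_apply, LinearEquiv.coe_coe] at k1 k2
  constructor
  · rintro ⟨n, rfl⟩
    refine ⟨(k1 _).trans ?_, (k2 _).trans ?_⟩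
    · rw [(N.exact_coaction _).2 ⟨n, rfl⟩, map_zero, map_zero]
    · have h0 : (cotensorMap X.right Y.toLeft).rTensor N.carrier
          ((α.rTensor N.carrier ∘ₗ N.coaction.map) n) = 0 := (h.exact _ _).2 ⟨_, rfl⟩
      rw [h0, map_zero, map_zero]
  · rintro ⟨h1, h2⟩
    obtain ⟨t, rfl⟩ := (TensorProduct.assoc R _ _ _).surjective t
    have hinj : Function.Injective ((TensorProduct.assoc R D Y.right.carrier
        N.carrier).toLinearMap.lTensor X.right.carrier) :=
      ((TensorProduct.assoc R D Y.right.carrier N.carrier).lTensor X.right.carrier).injective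
    have h3 : (cotensorMap X.right Y.toLeft).rTensor N.carrier t = 0 := by
      refine (TensorProduct.assoc R _ _ _).injective (hinj ?_)
      rw [← k2, h2, map_zero, map_zero]
    -- Purity at `V = N` brings `t` back to `C ⊗ N`; injectivity at `V = C ⊗ N` then puts `s` in `C
    -- □ N`.
    obtain ⟨s, rfl⟩ := (h.exact _ _).1 h3
    have h4 : cotensorMap (regular R C) N s = 0 := by
      refine h.injective _ ((TensorProduct.assoc R _ _ _).injective ?_)
      rw [← k1, h1, map_zero, map_zero]
    obtain ⟨n, rfl⟩ := (N.exact_coaction s).1 h4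
    exact ⟨n, rfl⟩

/-- The linear isomorphism `N ≃ X □ (Y □ N)`. -/
noncomputable def unitEquiv [Module.Flat R D] [Module.Flat R X.right.carrier]
    (h : IsCotensorUnit X Y α) (N : LeftComod R C) :
    N.carrier ≃ₗ[R] cotensor X.right (cotensorObj Y N) :=
  (LinearEquiv.ofInjective _ (h.unitMap_injective N)).trans
    ((LinearEquiv.ofEq _ _ (Submodule.ext fun t => (h.mem_range_unitMap N t).trans
      (mem_range_cotensorIncl X.right Y N t).symm)).trans
    (LinearEquiv.ofInjective _ (cotensorIncl_injective X.right Y N)).symm)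

theorem cotensorIncl_unitEquiv [Module.Flat R D] [Module.Flat R X.right.carrier]
    (h : IsCotensorUnit X Y α) (N : LeftComod R C) :
    cotensorIncl X.right Y N ∘ₗ (h.unitEquiv N).toLinearMap = unitMap α N := by
  ext n : 1
  exact congrArg Subtype.val (LinearEquiv.apply_symm_apply
    (LinearEquiv.ofInjective _ (cotensorIncl_injective X.right Y N)) _)

/-- Left colinearity of `α` reduces this to coassociativity of `N`. -/
theorem unitMap_colinear (h : IsCotensorUnit X Y α) (N : LeftComod R C) :
    (X.left.tensor (Y.right.carrier ⊗[R] N.carrier)).map ∘ₗ unitMap α N =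
      (unitMap α N).lTensor C ∘ₗ N.coaction.map := by
  have h1 : (X.left.tensor (Y.right.carrier ⊗[R] N.carrier)).map ∘ₗ
      (TensorProduct.assoc R _ _ _).toLinearMap ∘ₗ α.rTensor N.carrier =
      ((TensorProduct.assoc R _ _ _).toLinearMap ∘ₗ α.rTensor N.carrier).lTensor C ∘ₗ
        (TensorProduct.assoc R C C N.carrier).toLinearMap ∘ₗ
        (Coalgebra.comul (R := R) (A := C)).rTensor N.carrier := by
    refine TensorProduct.ext' fun c n => ?_
    have hl := LinearMap.congr_fun h.left c
    simp only [LinearMap.comp_apply, LinearEquiv.coe_coe] at hl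
    have h2 : ∀ t : X.right.carrier ⊗[R] Y.right.carrier,
        (X.left.tensor (Y.right.carrier ⊗[R] N.carrier)).map
          (TensorProduct.assoc R _ _ _ (t ⊗ₜ n)) =
        TensorProduct.assoc R _ _ _ (TensorProduct.assoc R _ _ _
          (X.left.map.rTensor Y.right.carrier t ⊗ₜ n)) := by
      intro t
      induction t with
      | zero => simp
      | add a b ha hb => simp only [TensorProduct.add_tmul, map_add, ha, hb]
      | tmul x y =>
        simp only [LeftCoaction.tensor, TensorProduct.assoc_tmul, LinearMap.comp_apply,
          LinearMap.rTensor_tmul, LinearEquiv.coe_coe]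
    have h3 : ∀ t : C ⊗[R] C,
        TensorProduct.assoc R _ _ _ (TensorProduct.assoc R _ _ _
          ((TensorProduct.assoc R C X.right.carrier Y.right.carrier).symm (α.lTensor C t) ⊗ₜ n)) =
        ((TensorProduct.assoc R _ _ _).toLinearMap ∘ₗ α.rTensor N.carrier).lTensor C
          (TensorProduct.assoc R C C N.carrier (t ⊗ₜ n)) := by
      intro t
      induction t with
      | zero => simp
      | add a b ha hb => simp only [TensorProduct.add_tmul, map_add, ha, hb]
      | tmul a b =>
        simp only [TensorProduct.assoc_tmul, LinearMap.lTensor_tmul, LinearMap.comp_apply,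
          LinearMap.rTensor_tmul, LinearEquiv.coe_coe]
        generalize α b = s
        induction s with
        | zero => simp
        | add a b ha hb => simp only [TensorProduct.add_tmul, TensorProduct.tmul_add, map_add, ha, hb]
        | tmul a b => simp
    simp only [LinearMap.comp_apply, LinearMap.rTensor_tmul, LinearEquiv.coe_coe]
    rw [h2, hl, h3]
  ext n : 1
  have k1 := LinearMap.congr_fun h1 (N.coaction.map n)
  have k2 := LinearMap.congr_fun N.coaction.coassoc n
  simp only [LinearMap.comp_apply] at k1 k2
  have e1 : (unitMap α N).lTensor C = ((TensorProduct.assoc R _ _ _).toLinearMap ∘ₗ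
      α.rTensor N.carrier).lTensor C ∘ₗ N.coaction.map.lTensor C := by
    rw [← LinearMap.lTensor_comp]; rfl
  rw [LinearMap.comp_apply, LinearMap.comp_apply, e1, LinearMap.comp_apply, k2]
  exact k1

theorem cotensorIncl_colinear [Module.Flat R C] [Module.Flat R D] (X : Bicomod R C D)
    (Y : Bicomod R D C) (N : LeftComod R C) :
    (X.left.tensor (Y.right.carrier ⊗[R] N.carrier)).map ∘ₗ cotensorIncl X.right Y N =
      (cotensorIncl X.right Y N).lTensor C ∘ₗ (cotensorObj X (cotensorObj Y N)).coaction.map := by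
  have h1 := LeftComod.lin_colinear (cotensorι X (cotensorObj Y N))
  have h2 : (X.left.tensor (Y.right.carrier ⊗[R] N.carrier)).map ∘ₗ
      (cotensor Y.right N).subtype.lTensor X.right.carrier =
      ((cotensor Y.right N).subtype.lTensor X.right.carrier).lTensor C ∘ₗ
        (X.left.tensor (cotensor Y.right N)).map := by
    refine TensorProduct.ext' fun x z => ?_
    simp only [LeftCoaction.tensor, LinearMap.comp_apply, LinearMap.rTensor_tmul,
      LinearMap.lTensor_tmul, LinearEquiv.coe_coe]
    generalize X.left.map x = s
    induction s with
    | zero => simp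
    | add a b ha hb => simp only [TensorProduct.add_tmul, map_add, ha, hb]
    | tmul a b => simp
  ext z : 1
  have k1 := LinearMap.congr_fun h1 z
  have k2 := LinearMap.congr_fun h2 z.1
  have e1 : (cotensorIncl X.right Y N).lTensor C =
      ((cotensor Y.right N).subtype.lTensor X.right.carrier).lTensor C ∘ₗ
      (cotensor X.right (cotensorObj Y N)).subtype.lTensor C := by
    rw [← LinearMap.lTensor_comp]; rfl
  rw [LinearMap.comp_apply (cotensorIncl X.right Y N |>.lTensor C), e1]
  exact k2.trans (congrArg (((cotensor Y.right N).subtype.lTensor X.right.carrier).lTensor C) k1)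

theorem unitEquiv_colinear [Module.Flat R C] [Module.Flat R D] [Module.Flat R X.right.carrier]
    (h : IsCotensorUnit X Y α) (N : LeftComod R C) :
    (cotensorObj X (cotensorObj Y N)).coaction.map ∘ₗ (h.unitEquiv N).toLinearMap =
      (h.unitEquiv N).toLinearMap.lTensor C ∘ₗ N.coaction.map := by
  have hinj : Function.Injective ((cotensorIncl X.right Y N).lTensor C) :=
    Module.Flat.lTensor_preserves_injective_linearMap _ (cotensorIncl_injective X.right Y N)
  refine (LinearMap.cancel_left hinj).1 ?_
  rw [← LinearMap.comp_assoc, ← cotensorIncl_colinear, LinearMap.comp_assoc,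
    cotensorIncl_unitEquiv, ← LinearMap.comp_assoc, ← LinearMap.lTensor_comp,
    cotensorIncl_unitEquiv, unitMap_colinear h]

/-- The natural isomorphism `id ≅ X □ (Y □ -)`. -/
noncomputable def unitIso [Module.Flat R C] [Module.Flat R D] [Module.Flat R X.right.carrier]
    (h : IsCotensorUnit X Y α) :
    𝟭 (LeftComod R C) ≅ cotensorFunctor Y ⋙ cotensorFunctor X :=
  NatIso.ofComponents
    (fun N => LeftComod.isoOfLinearEquiv (N := cotensorObj X (cotensorObj Y N))
      (h.unitEquiv N) (h.unitEquiv_colinear N)) (by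
    intro N N' f
    refine LeftComod.hom_ext ?_
    -- Naturality is checked inside `X ⊗ (Y ⊗ N')`, where the isomorphism is the explicit `unitMap`.
    refine (LinearMap.cancel_left (cotensorIncl_injective X.right Y N')).1 ?_
    have hf := LeftComod.lin_colinear f
    have h1 : cotensorIncl X.right Y N' ∘ₗ
        cotensorLin X.right (P := cotensorObj Y N) (Q := cotensorObj Y N')
          ((cotensorFunctor Y).map f) =
        ((LeftComod.lin f).lTensor Y.right.carrier).lTensor X.right.carrier ∘ₗ
          cotensorIncl X.right Y N := by
      ext z : 1
      refine LinearMap.congr_fun (f := (cotensor Y.right N').subtype.lTensor X.right.carrier ∘ₗ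
        (cotensorLin Y.right f).lTensor X.right.carrier)
        (g := ((LeftComod.lin f).lTensor Y.right.carrier).lTensor X.right.carrier ∘ₗ
          (cotensor Y.right N).subtype.lTensor X.right.carrier) ?_ z.1
      rw [← LinearMap.lTensor_comp, ← LinearMap.lTensor_comp]
      rfl
    have h2 : unitMap α N' ∘ₗ LeftComod.lin f =
        ((LeftComod.lin f).lTensor Y.right.carrier).lTensor X.right.carrier ∘ₗ unitMap α N := by
      have h3 : (TensorProduct.assoc R _ _ _).toLinearMap ∘ₗ α.rTensor N'.carrier ∘ₗ
          (LeftComod.lin f).lTensor C =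
          ((LeftComod.lin f).lTensor Y.right.carrier).lTensor X.right.carrier ∘ₗ
            (TensorProduct.assoc R _ _ _).toLinearMap ∘ₗ α.rTensor N.carrier := by
        refine TensorProduct.ext' fun c n => ?_
        simp only [LinearMap.comp_apply, LinearMap.rTensor_tmul, LinearMap.lTensor_tmul,
          LinearEquiv.coe_coe]
        generalize α c = s
        induction s with
        | zero => simp
        | add a b ha hb => simp only [TensorProduct.add_tmul, map_add, ha, hb]
        | tmul a b => simp
      ext n : 1
      have k1 := LinearMap.congr_fun hf n
      have k3 := LinearMap.congr_fun h3 (N.coaction.map n)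
      simp only [LinearMap.comp_apply, unitMap] at k1 k3 ⊢
      rw [k1, k3]
    change cotensorIncl X.right Y N' ∘ₗ (h.unitEquiv N').toLinearMap ∘ₗ LeftComod.lin f =
      cotensorIncl X.right Y N' ∘ₗ
        cotensorLin X.right (P := cotensorObj Y N) (Q := cotensorObj Y N')
          ((cotensorFunctor Y).map f) ∘ₗ
        (h.unitEquiv N).toLinearMap
    rw [← LinearMap.comp_assoc, cotensorIncl_unitEquiv, h2, ← LinearMap.comp_assoc, h1,
      LinearMap.comp_assoc, cotensorIncl_unitEquiv])

end IsCotensorUnit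

instance [Module.Flat R C] (X : Bicomod R C D) : (cotensorFunctor X).Additive where
  map_add {_ _ f g} := LeftComod.hom_ext (LinearMap.ext fun z => Subtype.ext
    (LinearMap.congr_fun (LinearMap.lTensor_add X.right.carrier (LeftComod.lin f)
      (LeftComod.lin g)) z.1))

instance [Module.Flat R C] (X : Bicomod R C D) : (cotensorFunctor X).Linear R where
  map_smul f r := LeftComod.hom_ext (LinearMap.ext fun z => Subtype.ext
    (LinearMap.congr_fun (LinearMap.lTensor_smul X.right.carrier r (LeftComod.lin f)) z.1))

end CotensorComp

/-! ### Purity of the unit map and the equivalence -/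

section Main

variable {R C D : Type u} [CommRing R] [AddCommGroup C] [Module R C] [Coalgebra R C]
  [AddCommGroup D] [Module R D] [Coalgebra R D]

/-- `F(C)` as a `C`-`D`-bicomodule. -/
noncomputable abbrev objBicomod (F : RightComod R C ⥤ RightComod R D) [F.Additive] [F.Linear R]
    [F.IsEquivalence] : Bicomod R C D :=
  ⟨F.obj (regular R C), leftCoaction F, leftCoaction_compatible F⟩

variable [Module.Flat R C]
  (F : RightComod R C ⥤ RightComod R D) [F.Additive] [F.Linear R] [F.IsEquivalence]
  (G : RightComod R D ⥤ RightComod R C) [G.Additive] [G.Linear R] [G.IsEquivalence]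
  (η : 𝟭 (RightComod R C) ≅ F ⋙ G)

theorem rTensor_comm {R M N : Type u} [CommRing R] [AddCommGroup M] [Module R M] [AddCommGroup N]
    [Module R N] (f : M →ₗ[R] N) (V : Type u) [AddCommGroup V] [Module R V] (t : V ⊗[R] M) :
    f.rTensor V (TensorProduct.comm R V M t) = TensorProduct.comm R V N (f.lTensor V t) :=
  LinearMap.congr_fun (f := f.rTensor V ∘ₗ (TensorProduct.comm R V M).toLinearMap)
    (g := (TensorProduct.comm R V N).toLinearMap ∘ₗ f.lTensor V)
    (TensorProduct.ext' fun _ _ => rfl) t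

/-- Only the factor `X` of `V ⊗ X` carries a coaction, so `V` is a spectator. This turns the kernel
for `V ⊗ F(C)` into exactness after tensoring with `V`. -/
theorem balancing_eq (X : RightComod R D) (P : LeftComod R D) (V : Type u) [AddCommGroup V]
    [Module R V] :
    ((tensorRight V X).coaction.map.rTensor P.carrier -
      (TensorProduct.assoc R (V ⊗[R] X.carrier) D P.carrier).symm.toLinearMap ∘ₗ
        P.coaction.map.lTensor (V ⊗[R] X.carrier)) ∘ₗ
      (TensorProduct.assoc R V X.carrier P.carrier).symm.toLinearMap =
    ((TensorProduct.assoc R (V ⊗[R] X.carrier) D P.carrier).symm.toLinearMap ∘ₗ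
      (TensorProduct.assoc R V X.carrier (D ⊗[R] P.carrier)).symm.toLinearMap) ∘ₗ
        (cotensorMap X P).lTensor V := by
  rw [cotensorMap, LinearMap.lTensor_sub, LinearMap.sub_comp]
  refine Eq.trans (congrArg₂ (· - ·) ?_ ?_) (LinearMap.comp_sub _ _ _).symm
  · ext v x y
    simp only [TensorProduct.AlgebraTensorModule.curry_apply, TensorProduct.curry_apply,
      LinearMap.coe_restrictScalars, LinearMap.comp_apply, LinearEquiv.coe_coe,
      LinearMap.rTensor_tmul, LinearMap.lTensor_tmul, TensorProduct.assoc_symm_tmul]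
    generalize X.coaction.map x = s
    induction s with
    | zero => simp
    | add a b ha hb => simp only [TensorProduct.add_tmul, TensorProduct.tmul_add, map_add, ha, hb]
    | tmul a b => simp
  · ext v x y
    simp only [TensorProduct.AlgebraTensorModule.curry_apply, TensorProduct.curry_apply,
      LinearMap.coe_restrictScalars, LinearMap.comp_apply, LinearEquiv.coe_coe,
      LinearMap.lTensor_tmul, TensorProduct.assoc_symm_tmul]

/-- Injectivity and exactness are `isKernel_unitHom` read on underlying modules, for which `C` must
be flat. -/
theorem isCotensorUnit_unitHom :
    IsCotensorUnit (objBicomod F) (objBicomod G) (RightComod.lin (unitHom F G η)) := by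
  have hlin : ∀ (V : Type u) [AddCommGroup V] [Module R V],
      RightComod.lin (tensorRightHom V (unitHom F G η) ≫ tensorRightAssoc V _ _) =
        (TensorProduct.assoc R V (F.obj (regular R C)).carrier
          (G.obj (regular R D)).carrier).symm.toLinearMap ∘ₗ
        (RightComod.lin (unitHom F G η)).lTensor V := fun V _ _ => by
    rw [RightComod.lin_comp, lin_tensorRightAssoc, lin_tensorRightHom]
  have hinj : ∀ (V : Type u) [AddCommGroup V] [Module R V],
      Function.Injective ((RightComod.lin (unitHom F G η)).lTensor V) := fun V _ _ => by
    have := (isKernel_unitHom F G η V).mono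
    have h := RightComod.injective_of_mono
      (tensorRightHom V (unitHom F G η) ≫ tensorRightAssoc V _ _)
    rw [hlin] at h
    exact Function.Injective.of_comp h
  have hbal : ∀ (V : Type u) [AddCommGroup V] [Module R V],
      RightComod.lin (balancingHom G (tensorRight V (F.obj (regular R C)))) ∘ₗ
        (TensorProduct.assoc R V _ _).symm.toLinearMap =
      ((TensorProduct.assoc R _ _ _).symm.toLinearMap ∘ₗ
        (TensorProduct.assoc R _ _ _).symm.toLinearMap) ∘ₗ
        (cotensorMap (F.obj (regular R C)) (objBicomod G).toLeft).lTensor V := fun V _ _ => by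
    rw [balancingHom, RightComod.lin_sub, RightComod.lin_comp, lin_tensorRightMap,
      lin_tensorRightHom, lin_tensorRightAssoc]
    exact balancing_eq (F.obj (regular R C)) (objBicomod G).toLeft V
  refine ⟨?_, ?_, fun V _ _ => ?_, fun V _ _ => ?_⟩
  · have h := congrArg RightComod.lin (unitHom_left F G η)
    rw [RightComod.lin_comp, RightComod.lin_comp, hlin, lin_tensorRightMap] at h
    exact h
  · exact RightComod.lin_colinear (unitHom F G η)
  -- Copowers carry the module on the left and `IsCotensorUnit` on the right, hence the passage
  -- through `TensorProduct.comm`.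
  · intro a b hab
    obtain ⟨a, rfl⟩ := (TensorProduct.comm R V C).surjective a
    obtain ⟨b, rfl⟩ := (TensorProduct.comm R V C).surjective b
    rw [rTensor_comm, rTensor_comm] at hab
    rw [hinj V ((TensorProduct.comm R V _).injective hab)]
  · intro t
    obtain ⟨t, rfl⟩ := (TensorProduct.comm R V _).surjective t
    have hex := (isKernel_unitHom F G η V).exact
      ((TensorProduct.assoc R V _ _).symm t)
    have k := LinearMap.congr_fun (hbal V) t
    simp only [LinearMap.comp_apply, LinearEquiv.coe_coe] at k
    rw [rTensor_comm, LinearEquiv.map_eq_zero_iff]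
    rw [k, LinearEquiv.map_eq_zero_iff, LinearEquiv.map_eq_zero_iff, hlin] at hex
    refine hex.trans ⟨?_, ?_⟩
    · rintro ⟨s, hs⟩
      refine ⟨TensorProduct.comm R V C s, ?_⟩
      rw [rTensor_comm]
      exact congrArg _ ((TensorProduct.assoc R V _ _).symm.injective hs)
    · rintro ⟨s, hs⟩
      obtain ⟨s, rfl⟩ := (TensorProduct.comm R V C).surjective s
      rw [rTensor_comm] at hs
      exact ⟨s, congrArg (TensorProduct.assoc R V _ _).symm
        ((TensorProduct.comm R V _).injective hs)⟩

end Main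

end MoritaTakeuchi

open MoritaTakeuchi in
theorem mainTheorem4 {R C D : Type u} [CommRing R]
    [AddCommGroup C] [Module R C] [Coalgebra R C] [Module.Flat R C]
    [AddCommGroup D] [Module R D] [Coalgebra R D] [Module.Flat R D]
    (e : RightComod R C ≌ RightComod R D) [e.functor.Additive] [e.functor.Linear R] :
    Function.Bijective (lam e.functor C (regular R C)) ∧
    Function.Bijective (lam e.inverse D (regular R D)) ∧
    ∃ (l : LeftCoaction R C (e.functor.obj (regular R C)).carrier)
      (hl : Compatible l (e.functor.obj (regular R C)).coaction)
      (l' : LeftCoaction R D (e.inverse.obj (regular R D)).carrier)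
      (hl' : Compatible l' (e.inverse.obj (regular R D)).coaction),
      lam e.functor C (regular R C) ∘ₗ l.map =
        RightComod.lin (e.functor.map (comulHom R C)) ∧
      lam e.inverse D (regular R D) ∘ₗ l'.map =
        RightComod.lin (e.inverse.map (comulHom R D)) ∧
      ∃ E : LeftComod R D ≌ LeftComod R C,
        E.functor = cotensorFunctor ⟨e.functor.obj (regular R C), l, hl⟩ ∧
        E.inverse = cotensorFunctor ⟨e.inverse.obj (regular R D), l', hl'⟩ ∧
        E.functor.Additive ∧ E.functor.Linear R := by
  have : Module.Flat R (objBicomod e.functor).right.carrier := flat_obj_regular e.functor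
  have : Module.Flat R (objBicomod e.inverse).right.carrier := flat_obj_regular e.inverse
  exact ⟨lam_bijective e.functor _, lam_bijective e.inverse _,
    leftCoaction e.functor, leftCoaction_compatible e.functor,
    leftCoaction e.inverse, leftCoaction_compatible e.inverse,
    lam_leftCoaction e.functor, lam_leftCoaction e.inverse,
    -- The unit on left `D`-comodules comes from the inverse counit of `e`, with the two functors
    -- exchanged. `Equivalence.mk` arranges the triangle identity without changing the functors.
    CategoryTheory.Equivalence.mk (cotensorFunctor (objBicomod e.functor))
      (cotensorFunctor (objBicomod e.inverse))
      (isCotensorUnit_unitHom e.inverse e.functor e.counitIso.symm).unitIso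
      (isCotensorUnit_unitHom e.functor e.inverse e.unitIso).unitIso.symm,
    rfl, rfl, inferInstanceAs (cotensorFunctor (objBicomod e.functor)).Additive,
    inferInstanceAs ((cotensorFunctor (objBicomod e.functor)).Linear R)⟩
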